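/- Let $(N,g)$ be a smooth (Hausdorff) Riemannian manifold of dimension $n$, without boundary. For $x\in N$ let $\exp_x$ be the geodesic exponential map at $x$, defined on the open set of those $v\in T_xN$ for which the geodesic $\gamma$ with $\gamma(0)=x$, $\dot\gamma(0)=v$ exists on $[0,1]$, with $\exp_x(v)=\gamma(1)$. For $v$ in this domain, $x$ and $\exp_x(v)$ are called conjugate along $\gamma$ if $\ker \mathrm d(\exp_x)_v\neq 0$, and $\dim\ker \mathrm d(\exp_x)_v$ is then their multiplicity; the conjugate locus of $x$ is the set of all points $\exp_x(v)$ that are conjugate to $x$ in this way. (i) If $x$ and $\exp_x(v)$ are conjugate along the geodesic with initial velocity $v$, then their multiplicity is at most $n-1$. (ii) Let $\omega$ be the canonical symplectic form on $\pi\colon T^*N\to N$, let $\Phi$ be the time-1-map of the Hamiltonian flow of $H(\alpha)=\frac12\alpha(g^{-1}\alpha)$ (defined where the flow exists up to time 1), and let $\Gamma\subset T^*N\times T^*N$ be its graph. Let $X$ be a point in the conjugate locus of $x$, and let $\alpha\in T^*N$ solve the boundary value problem $\pi(\alpha)=x$, $\pi(\Phi(\alpha))=X$. Then the degeneracy of the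 singularity of this problem at $\alpha$ is at most $n-1$. Here the degeneracy is defined as follows. Put $\Pi=T_x^*N\times T_X^*N$ and $p=(\alpha,\Phi(\alpha))\in\Gamma\cap\Pi$. Take a symplectomorphism $\Psi$ from a neighbourhood $U$ of $p$ in $(T^*N\times T^*N,\omega\oplus(-\omega))$ onto an open subset of $T^*\mathbb R^{2n}$ that maps $\Gamma\cap U$ and $\Pi\cap U$ onto the images of exact 1-forms $\mathrm df$ and $\mathrm dh$ with smooth functions $f,h$ on an open set $D\subset\mathbb R^{2n}$. The degeneracy is the dimension of the kernel of the Hessian of $f-h$ at the base point of $\Psi(p)$. The bound holds for every choice of $\Psi,D,f,h$. -/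

import Mathlib

open Set Bundle Manifold Module
open scoped ContDiff Topology

noncomputable section

namespace ConjugatePoints

variable {E : Type*} [NormedAddCommGroup E] [NormedSpace ℝ E]
  {M : Type*} [TopologicalSpace M] [ChartedSpace E M]

/-! ### Geodesics, the exponential map, conjugate points -/

section Geodesics

variable [RiemannianBundle (fun x : M ↦ TangentSpace 𝓘(ℝ, E) x)]

/-- The Riemannian metric in the chart centred at `c`: the inner product of the tangent vectors at
the point with coordinates `u` whose coordinates are `v` and `w`. -/
def chartMetric (c : M) (u v w : E) : ℝ :=
  letI D : E →L[ℝ] TangentSpace 𝓘(ℝ, E) ((extChartAt 𝓘(ℝ, E) c).symm u) :=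
    mfderiv 𝓘(ℝ, E) 𝓘(ℝ, E) (extChartAt 𝓘(ℝ, E) c).symm u
  inner ℝ (D v) (D w)

/-- The Christoffel symbols of the first kind of the Levi-Civita connection in the chart centred at
`c`: `christoffel c u v w z` is `g(∇_V W, Z)` at the point with coordinates `u`, where `V`, `W`, `Z`
are the vector fields with constant coordinates `v`, `w`, `z`. -/
def christoffel (c : M) (u v w z : E) : ℝ :=
  (fderiv ℝ (fun u' ↦ chartMetric c u' w z) u v
    + fderiv ℝ (fun u' ↦ chartMetric c u' v z) u w
    - fderiv ℝ (fun u' ↦ chartMetric c u' v w) u z) / 2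

/-- A curve is a geodesic on the open set `J` of times if, at each `t ∈ J`, it is twice
differentiable and its covariant acceleration vanishes. With `q` the curve read in a chart at
`γ t`, the last condition says `g(q'' + Γ(q', q'), z) = 0` for all `z`. -/
def IsGeodesicOn (γ : ℝ → M) (J : Set ℝ) : Prop :=
  ∀ t ∈ J, ContinuousAt γ t ∧
    letI q : ℝ → E := fun s ↦ extChartAt 𝓘(ℝ, E) (γ t) (γ s)
    (∀ᶠ s in 𝓝 t, DifferentiableAt ℝ q s) ∧ DifferentiableAt ℝ (deriv q) t ∧
      ∀ z : E, chartMetric (γ t) (q t) (deriv (deriv q) t) z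
        + christoffel (γ t) (q t) (deriv q t) (deriv q t) z = 0

/-- `γ` is a geodesic, defined on an open interval around `[0, 1]`, that starts at `x` with
velocity `v`. -/
def IsGeodesicFrom (x : M) (v : TangentSpace 𝓘(ℝ, E) x) (γ : ℝ → M) : Prop :=
  (∃ ε > 0, IsGeodesicOn (E := E) γ (Ioo (-ε) (1 + ε))) ∧
    (⟨γ 0, mfderiv 𝓘(ℝ, ℝ) 𝓘(ℝ, E) γ 0 (1 : ℝ)⟩ : TangentBundle 𝓘(ℝ, E) M) = ⟨x, v⟩

/-- The domain of the exponential map at `x`. -/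
def expDomain (x : M) : Set (TangentSpace 𝓘(ℝ, E) x) :=
  {v | ∃ γ, IsGeodesicFrom x v γ}

open Classical in
/-- The geodesic exponential map at `x`: it sends `v` to `γ 1`, where `γ` is the geodesic that
starts at `x` with velocity `v`. Outside of `expDomain x` the value is irrelevant. -/
def expMap (x : M) (v : TangentSpace 𝓘(ℝ, E) x) : M :=
  if h : ∃ γ, IsGeodesicFrom x v γ then h.choose 1 else x

/-- The kernel of the differential of the exponential map at `v`. -/
def expKer (x : M) (v : TangentSpace 𝓘(ℝ, E) x) : Submodule ℝ (TangentSpace 𝓘(ℝ, E) x) :=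
  LinearMap.ker (mfderiv 𝓘(ℝ, TangentSpace 𝓘(ℝ, E) x) 𝓘(ℝ, E) (expMap x) v).toLinearMap

/-- `x` and `expMap x v` are conjugate points along the geodesic with initial velocity `v`:
`v` is a critical point of the exponential map at `x`. -/
def IsConjugateAlong (x : M) (v : TangentSpace 𝓘(ℝ, E) x) : Prop :=
  v ∈ expDomain x ∧ expKer x v ≠ ⊥

/-- The multiplicity of `x` and `expMap x v` as conjugate points along the geodesic with initial
velocity `v`. -/
def conjMultiplicity (x : M) (v : TangentSpace 𝓘(ℝ, E) x) : ℕ :=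
  finrank ℝ (expKer x v)

variable (E) in
/-- The set of all points conjugate to `x`. -/
def conjugateLocus (x : M) : Set M :=
  {X | ∃ v : TangentSpace 𝓘(ℝ, E) x, IsConjugateAlong x v ∧ expMap x v = X}

end Geodesics

/-! ### The Hamiltonian boundary value problem on the cotangent bundle -/

variable [IsManifold 𝓘(ℝ, E) ∞ M]

variable (E M) in
/-- The cotangent bundle of `M`, with its structure of a manifold. -/
abbrev CotangentBundle : Type _ :=
  TotalSpace (E →L[ℝ] ℝ) (fun x : M ↦ TangentSpace 𝓘(ℝ, E) x →L[ℝ] Trivial M ℝ x)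

variable (E) in
/-- The model with corners of the cotangent bundle. -/
abbrev cotangentModel : ModelWithCorners ℝ (E × (E →L[ℝ] ℝ)) (ModelProd E (E →L[ℝ] ℝ)) :=
  𝓘(ℝ, E).prod 𝓘(ℝ, E →L[ℝ] ℝ)

/-- The standard symplectic form `∑ dxʲ ∧ dyⱼ` on `T*V = V × V*`. -/
def stdSymplectic {V : Type*} [NormedAddCommGroup V] [NormedSpace ℝ V]
    (a b : V × (V →L[ℝ] ℝ)) : ℝ :=
  b.2 a.1 - a.2 b.1

/-- The canonical coordinates `(x, y)` on the cotangent bundle induced by the chart of `M` centred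
at `c`: `x` are the coordinates of the base point and `y` those of the covector. -/
def canonicalCoords (c : M) (α : CotangentBundle E M) : E × (E →L[ℝ] ℝ) :=
  (extChartAt 𝓘(ℝ, E) c α.proj,
    letI y : TangentSpace 𝓘(ℝ, E) α.proj →L[ℝ] ℝ := α.2
    letI D : E →L[ℝ] TangentSpace 𝓘(ℝ, E) α.proj :=
      mfderiv 𝓘(ℝ, E) 𝓘(ℝ, E) (extChartAt 𝓘(ℝ, E) c).symm (extChartAt 𝓘(ℝ, E) c α.proj)
    y ∘L D)

/-- The canonical symplectic form of the cotangent bundle at `α`. -/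
def cotangentSymplectic (α : CotangentBundle E M)
    (ξ η : TangentSpace (cotangentModel E) α) : ℝ :=
  letI D : TangentSpace (cotangentModel E) α →L[ℝ] E × (E →L[ℝ] ℝ) :=
    mfderiv (cotangentModel E) 𝓘(ℝ, E × (E →L[ℝ] ℝ)) (canonicalCoords α.proj) α
  stdSymplectic (D ξ) (D η)

section Hamiltonian

variable [FiniteDimensional ℝ E] [RiemannianBundle (fun x : M ↦ TangentSpace 𝓘(ℝ, E) x)]

/-- The geodesic Hamiltonian `H(α) = α(g⁻¹ α) / 2`. -/
def geodesicHamiltonian (α : CotangentBundle E M) : ℝ :=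
  letI y : TangentSpace 𝓘(ℝ, E) α.proj →L[ℝ] ℝ := α.2
  haveI : FiniteDimensional ℝ (TangentSpace 𝓘(ℝ, E) α.proj) :=
    inferInstanceAs (FiniteDimensional ℝ E)
  haveI : CompleteSpace (TangentSpace 𝓘(ℝ, E) α.proj) := FiniteDimensional.complete ℝ _
  y ((InnerProductSpace.toDual ℝ (TangentSpace 𝓘(ℝ, E) α.proj)).symm y) / 2

/-- `a` is a motion of the Hamiltonian system on the open set `J` of times: its velocity at each
`t ∈ J` is the Hamiltonian vector field `X_H`, given by `ω(X_H, ·) = dH`. -/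
def IsHamiltonianMotionOn (a : ℝ → CotangentBundle E M) (J : Set ℝ) : Prop :=
  ∀ t ∈ J, ∃ ξ : TangentSpace (cotangentModel E) (a t),
    HasMFDerivAt 𝓘(ℝ, ℝ) (cotangentModel E) a t ((1 : ℝ →L[ℝ] ℝ).smulRight ξ) ∧
    ∀ η : TangentSpace (cotangentModel E) (a t),
      cotangentSymplectic (a t) ξ η
        = mfderiv (cotangentModel E) 𝓘(ℝ, ℝ) geodesicHamiltonian (a t) η

variable (E M) in
/-- The graph of the time-1-map of the Hamiltonian flow. -/
def flowGraph : Set (CotangentBundle E M × CotangentBundle E M) :=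
  {p | ∃ ε > 0, ∃ a : ℝ → CotangentBundle E M,
    IsHamiltonianMotionOn a (Ioo (-ε) (1 + ε)) ∧ a 0 = p.1 ∧ a 1 = p.2}

end Hamiltonian

variable (E) in
/-- The boundary condition `π(α) = x`, `π(β) = X`. -/
def boundarySet (x X : M) : Set (CotangentBundle E M × CotangentBundle E M) :=
  {p | p.1.proj = x ∧ p.2.proj = X}

/-- `Ψ` is a local symplectomorphism from `(T*M × T*M, ω ⊕ -ω)` to `T*W`, where the space
`W = E × E` has the dimension of `T*M`. -/
def IsLocalSymplectomorphism
    (Ψ : OpenPartialHomeomorph (CotangentBundle E M × CotangentBundle E M)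
      ((E × E) × ((E × E) →L[ℝ] ℝ))) : Prop :=
  ContMDiffOn ((cotangentModel E).prod (cotangentModel E)) 𝓘(ℝ, (E × E) × ((E × E) →L[ℝ] ℝ)) ∞
    Ψ Ψ.source ∧
  ContMDiffOn 𝓘(ℝ, (E × E) × ((E × E) →L[ℝ] ℝ)) ((cotangentModel E).prod (cotangentModel E)) ∞
    Ψ.symm Ψ.target ∧
  ∀ p ∈ Ψ.source, ∀ ξ η : TangentSpace (cotangentModel E) p.1 × TangentSpace (cotangentModel E) p.2,
    letI D : TangentSpace (cotangentModel E) p.1 × TangentSpace (cotangentModel E) p.2 →L[ℝ]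
        (E × E) × ((E × E) →L[ℝ] ℝ) :=
      mfderiv ((cotangentModel E).prod (cotangentModel E))
        𝓘(ℝ, (E × E) × ((E × E) →L[ℝ] ℝ)) Ψ p
    stdSymplectic (D ξ) (D η)
      = cotangentSymplectic p.1 ξ.1 η.1 - cotangentSymplectic p.2 ξ.2 η.2

/-- `m` is the degeneracy of the singularity, at the solution `p`, of the boundary value problem
given by the graph `Γ` of a symplectic map and the boundary condition `B`: a local
symplectomorphism to a cotangent bundle turns `Γ` and `B`, near `p`, into the images of exact
1-forms `df` and `dh`, and the Hessian of `f - h` at the base point corresponding to `p` has a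
kernel of dimension `m`. -/
def HasDegeneracy (Γ B : Set (CotangentBundle E M × CotangentBundle E M))
    (p : CotangentBundle E M × CotangentBundle E M) (m : ℕ) : Prop :=
  ∃ (Ψ : OpenPartialHomeomorph (CotangentBundle E M × CotangentBundle E M)
      ((E × E) × ((E × E) →L[ℝ] ℝ))) (D : Set (E × E)) (f h : E × E → ℝ),
    IsLocalSymplectomorphism Ψ ∧ p ∈ Ψ.source ∧
    IsOpen D ∧ ContDiffOn ℝ ∞ f D ∧ ContDiffOn ℝ ∞ h D ∧
    Ψ '' (Γ ∩ Ψ.source) = (fun w ↦ (w, fderiv ℝ f w)) '' D ∧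
    Ψ '' (B ∩ Ψ.source) = (fun w ↦ (w, fderiv ℝ h w)) '' D ∧
    finrank ℝ (LinearMap.ker
      (fderiv ℝ (fun w ↦ fderiv ℝ (fun w' ↦ f w' - h w') w) (Ψ p).1).toLinearMap) = m

end ConjugatePoints

end

/-! Bound (i). The exponential map sends the ray through `w` to a geodesic: `exp_x (r w) = γ r`,
where `γ` has initial velocity `w`. If `s w = v` and `w ≠ 0`, the differential of `exp_x` at `v`
therefore sends `w` to the velocity of `γ` at time `s`. This velocity is not zero: zero vectors are
rest points of the geodesic spray, and integral curves are unique on the Hausdorff tangent bundle.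
So the kernel is a proper subspace of the tangent space, of dimension less than `n`
(`finrank_expKer_lt`).

Bound (ii). If `u` lies in the kernel of the Hessian of `f - h` at the base point, the Hessians of
`f` and `h` agree on `u`, so the graphs of `df` and `dh` share the tangent vector `(u, D²f u)`.
Pulled back by `Ψ`, it is tangent to the flow graph and annihilates the differentials of both base
points. It is thus a variation of the motion that moves the initial and final covectors but, to
first order, neither end point. Hamiltonian motions project to geodesics with velocity `g⁻¹ α`, so
raising the index of the initial covector variation gives an element of the kernel of `d exp_x` at
`g⁻¹ α`. This assignment is injective: if the initial variation vanishes, the flow carries it to a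
vanishing final one, and the differential of `Ψ⁻¹` is injective. Hence the degeneracy is at most the
dimension of that kernel (`finrank_le_finrank_expKer`), and the estimate behind (i) applies at `g⁻¹
α`.

Both bounds need `exp_x` to be differentiable. `geodesicAcc_transition` makes the spray a smooth
vector field on the tangent bundle. Its flow is differentiated locally through the variational
equation and a Grönwall estimate (`hasFDerivAt_flow_of_variational`), and continued along a whole
integral curve by composing local flow maps (`IsMIntegralCurveOn.exists_isFlowMapAt`). -/

noncomputable section

/-! ### Differentiable dependence of solutions of ODEs on the initial value -/

section LocalFlow

open Filter Metric NNReal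

variable {F : Type*} [NormedAddCommGroup F] [NormedSpace ℝ F]

/-- First-order Taylor estimate for a function whose derivative is Lipschitz on a convex set. -/
theorem norm_sub_sub_fderiv_le_of_lipschitzOnWith {f : F → F} {s : Set F} (hs : Convex ℝ s)
    (hf : ∀ x ∈ s, DifferentiableAt ℝ f x) {C : ℝ≥0} (hC : LipschitzOnWith C (fderiv ℝ f) s)
    {a b : F} (ha : a ∈ s) (hb : b ∈ s) :
    ‖f b - f a - fderiv ℝ f a (b - a)‖ ≤ C * ‖b - a‖ ^ 2 := by
  have hsub : segment ℝ a b ⊆ s := hs.segment_subset ha hb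
  have := (convex_segment a b).norm_image_sub_le_of_norm_hasFDerivWithin_le'
    (f := f) (f' := fderiv ℝ f) (φ := fderiv ℝ f a) (C := C * ‖b - a‖) (x := a) (y := b)
    (fun x hx ↦ (hf x (hsub hx)).hasFDerivAt.hasFDerivWithinAt)
    (fun x hx ↦ ?_) (left_mem_segment ℝ a b) (right_mem_segment ℝ a b)
  · calc _ ≤ _ := this
      _ = _ := by ring
  · have h1 := hC.dist_le_mul x (hsub hx) a ha
    rw [dist_eq_norm, dist_eq_norm] at h1
    have h2 : ‖x - a‖ ≤ ‖b - a‖ := by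
      have := (segment_subset_closedBall_left a b) hx
      rwa [mem_closedBall, dist_eq_norm, dist_eq_norm, norm_sub_rev a b] at this
    exact h1.trans (by gcongr)

/-- With no initial error the bound is linear in the forcing term, so a forcing quadratic in the
initial displacement leaves a quadratic error. -/
theorem gronwallBound_zero_mul (K c x : ℝ) :
    gronwallBound 0 K c x = c * gronwallBound 0 K 1 x := by
  by_cases hK : K = 0
  · subst hK; simp [gronwallBound_K0]
  · simp only [gronwallBound_of_K_ne_0 hK]; ring

/-- If `A` solves the variational equation along `α x`, the flow `α` is differentiable at `x`. -/
theorem hasFDerivAt_flow_of_variational {f : F → F} {s : Set F} (hs : Convex ℝ s)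
    (hf : ∀ x ∈ s, DifferentiableAt ℝ f x) {K C : ℝ≥0} (hK : LipschitzOnWith K f s)
    (hK' : ∀ x ∈ s, ‖fderiv ℝ f x‖ ≤ K)
    (hC : LipschitzOnWith C (fderiv ℝ f) s) {α : F → ℝ → F} {A : ℝ → F →L[ℝ] F} {x : F} {T : ℝ}
    (hT : 0 ≤ T) (hα0 : ∀ᶠ y in 𝓝 x, α y 0 = y)
    (hα : ∀ᶠ y in 𝓝 x, ∀ t ∈ Icc 0 T, α y t ∈ s ∧ HasDerivAt (α y) (f (α y t)) t)
    (hA0 : A 0 = 1)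
    (hA : ∀ t ∈ Icc 0 T, HasDerivAt A (fderiv ℝ f (α x t) ∘L A t) t) :
    HasFDerivAt (α · T) (A T) x := by
  have hx0 := hα0.self_of_nhds
  have hx := hα.self_of_nhds
  -- Grönwall is used twice: once to bound the separation of two trajectories by `‖y - x‖ * exp (K
  -- t)`, then for the remainder, which starts at 0 and solves the linearised equation up to a
  -- Taylor error quadratic in that separation.
  have key : ∀ᶠ y in 𝓝 x, ‖α y T - α x T - A T (y - x)‖
      ≤ (C * Real.exp (K * T) ^ 2 * gronwallBound 0 K 1 T) * ‖y - x‖ ^ 2 := by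
    filter_upwards [hα0, hα] with y hy0 hy
    have hlip : ∀ t ∈ Icc 0 T, ‖α y t - α x t‖ ≤ ‖y - x‖ * Real.exp (K * T) := by
      intro t ht
      have := dist_le_of_trajectories_ODE_of_mem (v := fun _ ↦ f) (s := fun _ ↦ s) (K := K)
        (f := α y) (g := α x) (a := 0) (b := T) (δ := ‖y - x‖)
        (fun _ _ ↦ hK) (fun t ht ↦ (hy t ht).2.continuousAt.continuousWithinAt)
        (fun t ht ↦ (hy t (Ico_subset_Icc_self ht)).2.hasDerivWithinAt)
        (fun t ht ↦ (hy t (Ico_subset_Icc_self ht)).1)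
        (fun t ht ↦ (hx t ht).2.continuousAt.continuousWithinAt)
        (fun t ht ↦ (hx t (Ico_subset_Icc_self ht)).2.hasDerivWithinAt)
        (fun t ht ↦ (hx t (Ico_subset_Icc_self ht)).1)
        (by rw [hy0, hx0, dist_eq_norm]) t ht
      rw [dist_eq_norm] at this
      refine this.trans ?_
      gcongr
      simpa using ht.2
    have hder : ∀ t ∈ Icc 0 T, HasDerivAt (fun t ↦ α y t - α x t - A t (y - x))
        (f (α y t) - f (α x t) - fderiv ℝ f (α x t) (A t (y - x))) t := by
      intro t ht
      refine ((hy t ht).2.sub (hx t ht).2).sub ?_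
      have := (hA t ht).clm_apply (hasDerivAt_const t (y - x))
      simpa using this
    have := norm_le_gronwallBound_of_norm_deriv_right_le (a := 0) (b := T) (δ := 0) (K := K)
      (ε := C * (‖y - x‖ * Real.exp (K * T)) ^ 2)
      (fun t ht ↦ (hder t ht).continuousAt.continuousWithinAt)
      (fun t ht ↦ (hder t (Ico_subset_Icc_self ht)).hasDerivWithinAt)
      (by simp [hy0, hx0, hA0]) ?_ T (right_mem_Icc.2 hT)
    · refine this.trans (le_of_eq ?_)
      rw [gronwallBound_zero_mul, sub_zero]; ring
    · intro t ht
      have ht := Ico_subset_Icc_self ht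
      have e : f (α y t) - f (α x t) - fderiv ℝ f (α x t) (A t (y - x))
          = (f (α y t) - f (α x t) - fderiv ℝ f (α x t) (α y t - α x t))
            + fderiv ℝ f (α x t) (α y t - α x t - A t (y - x)) := by
        simp only [map_sub]; abel
      rw [e]
      have h1 := norm_sub_sub_fderiv_le_of_lipschitzOnWith hs hf hC (hx t ht).1 (hy t ht).1
      have h2 := (fderiv ℝ f (α x t)).le_of_opNorm_le (hK' _ (hx t ht).1)
        (α y t - α x t - A t (y - x))
      have h3 : (C : ℝ) * ‖α y t - α x t‖ ^ 2 ≤ C * (‖y - x‖ * Real.exp (K * T)) ^ 2 := by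
        gcongr; exact hlip t ht
      exact (norm_add_le _ _).trans (by linarith)
  rw [hasFDerivAt_iff_isLittleO]
  have h1 : (fun y ↦ α y T - α x T - A T (y - x)) =O[𝓝 x] fun y ↦ ‖y - x‖ ^ 2 :=
    Asymptotics.IsBigO.of_bound _ (key.mono fun y hy ↦ by simpa using hy)
  exact h1.trans_isLittleO ((Asymptotics.isLittleO_pow_sub_sub x one_lt_two))

/-- A `C²` vector field has a local flow, staying in a prescribed neighbourhood, that depends
differentiably on the initial value. -/
theorem ContDiffAt.exists_differentiableAt_flow [CompleteSpace F] {f : F → F} {x₀ : F}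
    (hf : ContDiffAt ℝ 2 f x₀) {U : Set F} (hU : U ∈ 𝓝 x₀) :
    ∃ ε > 0, ∃ r > 0, ∃ α : F → ℝ → F, ∀ x ∈ ball x₀ r, α x 0 = x ∧
      (∀ t ∈ Ioo (-ε) ε, α x t ∈ U ∧ HasDerivAt (α x) (f (α x t)) t) ∧
      ∀ t ∈ Ico 0 ε, DifferentiableAt ℝ (α · t) x := by
  have hf1 : ContDiffAt ℝ 1 (fderiv ℝ f) x₀ := hf.fderiv_right (by norm_num)
  obtain ⟨K, s₁, hs₁, hK⟩ := (hf.of_le (by norm_num : (1 : WithTop ℕ∞) ≤ 2)).exists_lipschitzOnWith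
  obtain ⟨C, s₂, hs₂, hC⟩ := hf1.exists_lipschitzOnWith
  have hdiff : ∀ᶠ x in 𝓝 x₀, DifferentiableAt ℝ f x := by
    filter_upwards [hf.eventually (by simp)] with x hx using hx.differentiableAt (by simp)
  obtain ⟨ρ, hρ, hρs⟩ := Metric.mem_nhds_iff.1 (inter_mem (inter_mem hs₁ hs₂) (inter_mem hdiff hU))
  -- The equation is solved jointly with its variational equation. The augmented field is still `C¹`
  -- because `f` is `C²`; starting it at `(x, 1)` yields the trajectory and the candidate for its
  -- derivative in `x`.
  let g : F × (F →L[ℝ] F) → F × (F →L[ℝ] F) := fun p ↦ (f p.1, fderiv ℝ f p.1 ∘L p.2)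
  have hg : ContDiffAt ℝ 1 g (x₀, 1) := by
    refine ContDiffAt.prodMk ?_ ?_
    · exact ContDiffAt.comp (x₀, (1 : F →L[ℝ] F))
        (hf.of_le (by norm_num : (1 : WithTop ℕ∞) ≤ 2)) contDiffAt_fst
    · exact ContDiffAt.clm_comp (ContDiffAt.comp (x₀, (1 : F →L[ℝ] F)) hf1 contDiffAt_fst)
        contDiffAt_snd
  obtain ⟨ε, hε, a, r, L, K', hr, hPL⟩ := IsPicardLindelof.of_contDiffAt_one hg
  obtain ⟨β, hβ, hβc⟩ :=
    (hPL 0).exists_forall_mem_closedBall_eq_hasDerivWithinAt_continuousOn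
  have hnhds : closedBall (x₀, (1 : F →L[ℝ] F)) r ×ˢ Icc (0 - ε) (0 + ε)
      ∈ 𝓝 ((x₀, (1 : F →L[ℝ] F)), (0 : ℝ)) :=
    prod_mem_nhds (closedBall_mem_nhds _ hr) (Icc_mem_nhds (by linarith) (by linarith))
  have hβ0 : β ((x₀, 1), 0) = (x₀, 1) := (hβ _ (mem_closedBall_self hr.le)).1
  have hcont : ContinuousAt (fun p : F × ℝ ↦ (β ((p.1, 1), p.2)).1) (x₀, 0) := by
    have h1 : ContinuousAt β ((fun p : F × ℝ ↦ ((p.1, (1 : F →L[ℝ] F)), p.2)) (x₀, 0)) :=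
      hβc.continuousAt hnhds
    exact continuousAt_fst.comp (ContinuousAt.comp h1 (by fun_prop))
  -- Joint continuity confines nearby trajectories to the ball on which the Lipschitz bounds hold.
  have hev : ∀ᶠ p : F × ℝ in 𝓝 (x₀, 0), (β ((p.1, 1), p.2)).1 ∈ ball x₀ ρ :=
    hcont (by simpa [hβ0] using ball_mem_nhds x₀ hρ)
  obtain ⟨δ, hδ, hδs⟩ := Metric.eventually_nhds_iff_ball.1 hev
  have hr' : 0 < min δ (r : ℝ) := lt_min hδ hr
  have hmem : ∀ x ∈ ball x₀ (min δ (r : ℝ)), (x, (1 : F →L[ℝ] F)) ∈ closedBall (x₀, 1) (r : ℝ) := by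
    intro x hx
    rw [mem_closedBall, Prod.dist_eq, dist_self, max_eq_left dist_nonneg]
    exact (lt_of_lt_of_le (mem_ball.1 hx) (min_le_right _ _)).le
  have hderiv : ∀ x ∈ ball x₀ (min δ (r : ℝ)), ∀ t ∈ Ioo (-min δ ε) (min δ ε),
      (β ((x, 1), t)).1 ∈ ball x₀ ρ ∧
        HasDerivAt (fun t ↦ β ((x, 1), t)) (g (β ((x, 1), t))) t := by
    intro x hx t ht
    have ht1 := lt_of_lt_of_le ht.2 (min_le_left _ _)
    have ht2 := lt_of_lt_of_le ht.2 (min_le_right _ _)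
    have ht3 := lt_of_le_of_lt (neg_le_neg (min_le_left δ ε)) ht.1
    have ht4 := lt_of_le_of_lt (neg_le_neg (min_le_right δ ε)) ht.1
    refine ⟨hδs (x, t) ?_, ?_⟩
    · rw [mem_ball, Prod.dist_eq]
      refine max_lt (lt_of_lt_of_le (mem_ball.1 hx) (min_le_left _ _)) ?_
      rw [Real.dist_eq, sub_zero, abs_lt]
      exact ⟨ht3, ht1⟩
    · exact ((hβ _ (hmem x hx)).2 t ⟨by linarith, by linarith⟩).hasDerivAt
        (Icc_mem_nhds (by linarith) (by linarith))
  have hsub1 : ball x₀ ρ ⊆ s₁ := fun y hy ↦ (hρs hy).1.1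
  have hsub2 : ball x₀ ρ ⊆ s₂ := fun y hy ↦ (hρs hy).1.2
  refine ⟨min δ ε, lt_min hδ hε, min δ r, hr', fun x t ↦ (β ((x, 1), t)).1, fun x hx ↦ ⟨?_, ?_, ?_⟩⟩
  · exact congrArg Prod.fst (hβ _ (hmem x hx)).1
  · exact fun t ht ↦ ⟨(hρs (hderiv x hx t ht).1).2.2, (hderiv x hx t ht).2.fst⟩
  · intro t ht
    have hI : ∀ u ∈ Icc 0 t, u ∈ Ioo (-min δ ε) (min δ ε) := fun u hu ↦
      ⟨lt_of_lt_of_le (neg_lt_zero.2 (lt_min hδ hε)) hu.1, lt_of_le_of_lt hu.2 ht.2⟩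
    have hball : ∀ᶠ y in 𝓝 x, y ∈ ball x₀ (min δ (r : ℝ)) := isOpen_ball.mem_nhds hx
    refine (hasFDerivAt_flow_of_variational (α := fun x t ↦ (β ((x, 1), t)).1) (x := x)
      (A := fun u ↦ (β ((x, 1), u)).2) (K := K) (C := C)
      (convex_ball x₀ ρ)
      (fun y hy ↦ (hρs hy).2.1) (hK.mono hsub1)
      (fun y hy ↦ norm_fderiv_le_of_lipschitzOn ℝ (mem_of_superset (isOpen_ball.mem_nhds hy) hsub1)
        hK)
      (hC.mono hsub2) ht.1 ?_ ?_ ?_ ?_).differentiableAt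
    · filter_upwards [hball] with y hy using congrArg Prod.fst (hβ _ (hmem y hy)).1
    · filter_upwards [hball] with y hy u hu
      exact ⟨(hderiv y hy u (hI u hu)).1, (hderiv y hy u (hI u hu)).2.fst⟩
    · exact congrArg Prod.snd (hβ _ (hmem x hx)).1
    · exact fun u hu ↦ (hderiv x hx u (hI u hu)).2.snd

end LocalFlow

end

noncomputable section

/-! ### Flows of vector fields on manifolds -/

section ManifoldFlow

open Filter Metric

variable {F : Type*} [NormedAddCommGroup F] [NormedSpace ℝ F]
  {H : Type*} [TopologicalSpace H] {I : ModelWithCorners ℝ F H}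
  {N : Type*} [TopologicalSpace N] [ChartedSpace H N] [IsManifold I 1 N]
  {v : (x : N) → TangentSpace I x}

omit [IsManifold I 1 N] in
/-- The derivative of a curve, read in the chart centred at its value. -/
theorem hasMFDerivAt_curve_iff {γ : ℝ → N} {t : ℝ} {ξ : TangentSpace I (γ t)} :
    HasMFDerivAt 𝓘(ℝ, ℝ) I γ t ((1 : ℝ →L[ℝ] ℝ).smulRight ξ) ↔
      ContinuousAt γ t ∧ HasDerivAt (F := F) (fun s ↦ extChartAt I (γ t) (γ s)) ξ t := by
  refine and_congr_right fun _ ↦ ?_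
  have key (ζ : F) : HasFDerivWithinAt (fun s ↦ extChartAt I (γ t) (γ s))
      ((1 : ℝ →L[ℝ] ℝ).smulRight ζ) (range (id : ℝ → ℝ)) t ↔
      HasDerivAt (fun s ↦ extChartAt I (γ t) (γ s)) ζ t := by
    rw [range_id, hasFDerivWithinAt_univ, hasDerivAt_iff_hasFDerivAt]
    rfl
  exact key ξ

/-- A solution, in a chart, of the equation of integral curves of `v` gives an integral curve. -/
theorem hasMFDerivAt_extChartAt_symm_comp [BoundarylessManifold I N] {x₀ : N} {f : ℝ → F} {t : ℝ}
    (ht : f t ∈ interior (extChartAt I x₀).target)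
    (h : HasDerivAt f (tangentCoordChange I ((extChartAt I x₀).symm (f t)) x₀
      ((extChartAt I x₀).symm (f t)) (v ((extChartAt I x₀).symm (f t)))) t) :
    HasMFDerivAt 𝓘(ℝ, ℝ) I (fun s ↦ (extChartAt I x₀).symm (f s)) t
      ((1 : ℝ →L[ℝ] ℝ).smulRight (v ((extChartAt I x₀).symm (f t)))) := by
  have hf3' := mem_of_mem_of_subset ht interior_subset
  rw [hasMFDerivAt_curve_iff]
  refine ⟨(continuousAt_extChartAt_symm'' hf3').comp h.continuousAt, ?_⟩
  generalize hxt : (extChartAt I x₀).symm (f t) = xₜ at *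
  have hft1 : xₜ ∈ (extChartAt I x₀).source := by
    rw [← hxt]; exact (extChartAt I x₀).map_target hf3'
  have hft2 := mem_extChartAt_source (I := I) xₜ
  have h1 : HasFDerivAt (extChartAt I xₜ ∘ (extChartAt I x₀).symm)
      (tangentCoordChange I x₀ xₜ xₜ) (f t) := by
    have := hasFDerivWithinAt_tangentCoordChange (I := I) ⟨hft1, hft2⟩
    rw [← hxt, (extChartAt I x₀).right_inv hf3', hxt] at this
    exact this.hasFDerivAt (mem_of_superset (isOpen_interior.mem_nhds ht)
      (interior_subset.trans (extChartAt_target_subset_range x₀)))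
  have h2 := h1.comp_hasDerivAt t h
  exact h2.congr_deriv ((tangentCoordChange_comp ⟨⟨hft2, hft1⟩, hft2⟩).trans
    (tangentCoordChange_self hft2))

/-- A `C²` vector field on a manifold has a local flow that depends differentiably on the initial
point. -/
theorem exists_mdifferentiableAt_localFlow [CompleteSpace F] [BoundarylessManifold I N] {x₀ : N}
    (hv : ContMDiffAt I I.tangent 2 (fun x ↦ (⟨x, v x⟩ : TangentBundle I N)) x₀) :
    ∃ ε > 0, ∃ U ∈ 𝓝 x₀, ∃ β : N → ℝ → N, ∀ z ∈ U, β z 0 = z ∧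
      IsMIntegralCurveOn (β z) v (Ioo (-ε) ε) ∧
      ∀ t ∈ Ico 0 ε, MDifferentiableAt I I (β · t) z := by
  have hx : I.IsInteriorPoint x₀ := BoundarylessManifold.isInteriorPoint
  rw [contMDiffAt_iff] at hv
  obtain ⟨_, hv⟩ := hv
  have hint : interior (extChartAt I x₀).target ∈ 𝓝 (extChartAt I x₀ x₀) :=
    isOpen_interior.mem_nhds ((I.isInteriorPoint_iff).mp hx)
  obtain ⟨ε, hε, r, hr, α, hα⟩ := (hv.contDiffAt (range_mem_nhds_isInteriorPoint hx)).snd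
    |>.exists_differentiableAt_flow hint
  have hsrc : (extChartAt I x₀).source ∈ 𝓝 x₀ := extChartAt_source_mem_nhds x₀
  refine ⟨ε, hε, (extChartAt I x₀).source ∩ extChartAt I x₀ ⁻¹' ball (extChartAt I x₀ x₀) r,
    inter_mem hsrc ((continuousAt_extChartAt x₀).preimage_mem_nhds (ball_mem_nhds _ hr)),
    fun z t ↦ (extChartAt I x₀).symm (α (extChartAt I x₀ z) t), fun z hz ↦ ?_⟩
  obtain ⟨h0, h1, h2⟩ := hα _ hz.2
  refine ⟨?_, ?_, ?_⟩
  · simp only [h0]; exact (extChartAt I x₀).left_inv hz.1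
  · intro t ht
    exact (hasMFDerivAt_extChartAt_symm_comp (h1 t ht).1 (h1 t ht).2).hasMFDerivWithinAt
  · intro t ht
    have ht' : t ∈ Ioo (-ε) ε := ⟨by linarith [ht.1], ht.2⟩
    have hz1 : MDifferentiableAt I 𝓘(ℝ, F) (extChartAt I x₀) z :=
      mdifferentiableAt_extChartAt (by rw [← extChartAt_source I]; exact hz.1)
    have hz2 : MDifferentiableAt 𝓘(ℝ, F) 𝓘(ℝ, F) (α · t) (extChartAt I x₀ z) :=
      (h2 t ht).mdifferentiableAt
    have hz3 : MDifferentiableAt 𝓘(ℝ, F) I (extChartAt I x₀).symm (α (extChartAt I x₀ z) t) := by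
      have hm := interior_subset (h1 t ht').1
      have := mdifferentiableWithinAt_extChartAt_symm (I := I) hm
      exact this.mdifferentiableAt (mem_of_superset (isOpen_interior.mem_nhds (h1 t ht').1)
        (interior_subset.trans (extChartAt_target_subset_range x₀)))
    exact hz3.comp z (hz2.comp z hz1)

/-- `Φ` is the flow map of `v` from time `s` to time `t`, near `z₀`, and it is differentiable
at `z₀`. -/
def IsFlowMapAt (v : (x : N) → TangentSpace I x) (s t : ℝ) (Φ : N → N) (z₀ : N) : Prop :=
  MDifferentiableAt I I Φ z₀ ∧ ∀ᶠ z in 𝓝 z₀, ∃ ε > 0, ∃ σ : ℝ → N,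
    IsMIntegralCurveOn σ v (Ioo (s - ε) (t + ε)) ∧ σ s = z ∧ σ t = Φ z

variable [T2Space N] [BoundarylessManifold I N]

/-- Two integral curves on neighbourhoods of `[s, t]` that agree at `s` agree at `t`. -/
theorem IsMIntegralCurveOn.eq_of_eq
    (hv : ContMDiff I I.tangent 1 (fun x ↦ (⟨x, v x⟩ : TangentBundle I N)))
    {σ τ : ℝ → N} {a b a' b' s t : ℝ} (hσ : IsMIntegralCurveOn σ v (Ioo a b))
    (hτ : IsMIntegralCurveOn τ v (Ioo a' b')) (hs : s ∈ Ioo a b) (hs' : s ∈ Ioo a' b')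
    (ht : t ∈ Ioo a b) (ht' : t ∈ Ioo a' b') (h : σ s = τ s) : σ t = τ t :=
  isMIntegralCurveOn_Ioo_eqOn_of_contMDiff_boundaryless (a := max a a') (b := min b b') (t₀ := s)
    ⟨max_lt hs.1 hs'.1, lt_min hs.2 hs'.2⟩ hv
    (hσ.mono (Ioo_subset_Ioo (le_max_left ..) (min_le_left ..)))
    (hτ.mono (Ioo_subset_Ioo (le_max_right ..) (min_le_right ..))) h
    ⟨max_lt ht.1 ht'.1, lt_min ht.2 ht'.2⟩

/-- Uniqueness of integral curves: the value `Φ z` does not depend on the curve that witnesses it.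
-/
theorem IsFlowMapAt.apply_eq
    (hv : ContMDiff I I.tangent 1 (fun x ↦ (⟨x, v x⟩ : TangentBundle I N)))
    {s t : ℝ} {Φ : N → N} {z₀ : N} (hΦ : IsFlowMapAt v s t Φ z₀) (hst : s ≤ t) :
    ∀ᶠ z in 𝓝 z₀, ∀ (σ : ℝ → N) (a b : ℝ), IsMIntegralCurveOn σ v (Ioo a b) → a < s → t < b →
      σ s = z → σ t = Φ z := by
  filter_upwards [hΦ.2] with z ⟨ε, hε, τ, hτ, hτs, hτt⟩ σ a b hσ has htb hσs
  rw [← hτt]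
  exact hσ.eq_of_eq hv hτ (s := s) ⟨has, by linarith⟩ ⟨by linarith, by linarith⟩
    ⟨by linarith, htb⟩ ⟨by linarith, by linarith⟩ (hσs.trans hτs.symm)

/-- The two witness curves overlap around `s` and agree there, so they glue to one integral curve;
differentiability is the chain rule. -/
theorem IsFlowMapAt.comp
    (hv : ContMDiff I I.tangent 1 (fun x ↦ (⟨x, v x⟩ : TangentBundle I N)))
    {r s t : ℝ} {Φ Φ' : N → N} {z₀ : N} (hrs : r ≤ s) (hst : s ≤ t)
    (hΦ : IsFlowMapAt v r s Φ z₀) (hΦ' : IsFlowMapAt v s t Φ' (Φ z₀)) :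
    IsFlowMapAt v r t (Φ' ∘ Φ) z₀ := by
  refine ⟨hΦ'.1.comp z₀ hΦ.1, ?_⟩
  filter_upwards [hΦ.2, hΦ.1.continuousAt.eventually hΦ'.2] with z ⟨ε, hε, σ, hσ, hσr, hσs⟩
    ⟨δ, hδ, τ, hτ, hτs, hτt⟩
  have hs : s ∈ Ioo (r - ε) (s + ε) ∩ Ioo (s - δ) (t + δ) :=
    ⟨⟨by linarith, by linarith⟩, ⟨by linarith, by linarith⟩⟩
  have heq : σ s = τ s := hσs.trans hτs.symm
  refine ⟨min ε δ, lt_min hε hδ, piecewise (Ioo (r - ε) (s + ε)) σ τ, ?_, ?_, ?_⟩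
  · refine (isMIntegralCurveOn_piecewise hv hσ hτ hs heq).mono ?_
    intro u hu
    have h1 : r - ε < u := lt_of_le_of_lt (by linarith [min_le_left ε δ]) hu.1
    have h2 : u < t + δ := lt_of_lt_of_le hu.2 (by linarith [min_le_right ε δ])
    by_cases hus : u < s + ε
    · exact Or.inl ⟨h1, hus⟩
    · exact Or.inr ⟨by linarith, h2⟩
  · rw [piecewise_eq_of_mem _ _ _ (by constructor <;> linarith), hσr]
  · rw [eqOn_piecewise_of_isMIntegralCurveOn_Ioo hv hσ hτ hs heq ⟨by linarith, by linarith⟩, hτt]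
    rfl

/-- Along an integral curve, the flow map of a `C²` vector field exists and is differentiable. -/
theorem IsMIntegralCurveOn.exists_isFlowMapAt [CompleteSpace F]
    (hv : ContMDiff I I.tangent 2 (fun x ↦ (⟨x, v x⟩ : TangentBundle I N)))
    {Z : ℝ → N} {a b s T : ℝ} (hZ : IsMIntegralCurveOn Z v (Ioo a b)) (has : a < s) (hsT : s ≤ T)
    (hTb : T < b) : ∃ Φ, IsFlowMapAt v s T Φ (Z s) := by
  have hv1 : ContMDiff I I.tangent 1 (fun x ↦ (⟨x, v x⟩ : TangentBundle I N)) :=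
    hv.of_le (by norm_num)
  have hZΦ : ∀ {u t : ℝ} {Φ : N → N}, a < u → u ≤ t → t < b → IsFlowMapAt v u t Φ (Z u) →
      Φ (Z u) = Z t := fun hau hut htb hΦ ↦
    ((hΦ.apply_eq hv1 hut).self_of_nhds Z a b hZ hau htb rfl).symm
  have hcomp : ∀ {u t w : ℝ}, a < u → u ≤ t → t ≤ w → w < b → (∃ Φ, IsFlowMapAt v u t Φ (Z u)) →
      (∃ Φ, IsFlowMapAt v t w Φ (Z t)) → ∃ Φ, IsFlowMapAt v u w Φ (Z u) := by
    rintro u t w hau hut htw hwb ⟨Φ, hΦ⟩ ⟨Φ', hΦ'⟩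
    exact ⟨Φ' ∘ Φ, hΦ.comp hv1 hut htw (by rwa [hZΦ hau hut (by linarith) hΦ])⟩
  -- The field is autonomous, so the local flow at `Z t₁`, run for time `t - u`, serves as flow map
  -- between any two times near `t₁`.
  have hloc : ∀ t₁ ∈ Ioo a b, ∃ δ > 0, ∀ u ∈ Ioo (t₁ - δ) (t₁ + δ), ∀ t ∈ Ioo (t₁ - δ) (t₁ + δ),
      u ≤ t → ∃ Φ, IsFlowMapAt v u t Φ (Z u) := by
    intro t₁ ht₁
    obtain ⟨ε, hε, U, hU, β, hβ⟩ := exists_mdifferentiableAt_localFlow (hv (Z t₁))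
    have hcont : ContinuousAt Z t₁ :=
      (hZ.continuousWithinAt ht₁).continuousAt (Ioo_mem_nhds ht₁.1 ht₁.2)
    obtain ⟨δ, hδ, hδU⟩ := Metric.eventually_nhds_iff_ball.1
      (hcont.eventually (eventually_mem_nhds_iff.2 hU))
    -- The bound `δ` keeps `Z u` in the domain of the local flow; `ε / 2` forces `t - u < ε`.
    refine ⟨min δ (ε / 2), by positivity, fun u hu t ht hut ↦ ⟨fun z ↦ β z (t - u), ?_, ?_⟩⟩
    · have hm : U ∈ 𝓝 (Z u) := hδU u (by
        rw [Real.ball_eq_Ioo]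
        exact ⟨by linarith [hu.1, min_le_left δ (ε / 2)],
          by linarith [hu.2, min_le_left δ (ε / 2)]⟩)
      exact (hβ _ (mem_of_mem_nhds hm)).2.2 _ ⟨by linarith,
        by linarith [hu.1, ht.2, min_le_right δ (ε / 2)]⟩
    · have hm : U ∈ 𝓝 (Z u) := hδU u (by
        rw [Real.ball_eq_Ioo]
        exact ⟨by linarith [hu.1, min_le_left δ (ε / 2)],
          by linarith [hu.2, min_le_left δ (ε / 2)]⟩)
      filter_upwards [hm] with z hz
      have htu : t - u < ε := by linarith [hu.1, ht.2, min_le_right δ (ε / 2)]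
      -- The part of the lifetime `ε` that is left after time `t - u`.
      refine ⟨ε - (t - u), by linarith, β z ∘ (· - u), ?_, ?_, rfl⟩
      · have := (hβ z hz).2.1.comp_add (-u)
        refine IsMIntegralCurveOn.mono (s := _) this ?_
        intro w hw
        simp only [mem_Ioo] at hw
        exact ⟨by linarith [hw.1], by linarith [hw.2]⟩
      · simpa using (hβ z hz).1
  -- Continuous induction over `[s, T]`: the set of times up to which all flow maps from `s` exist
  -- is closed, contains `s`, and extends to the right of each of its points; closedness and
  -- extension both follow from `hloc` and composition.
  have hclosed : IsClosed ({t | ∀ u ∈ Icc s t, ∃ Φ, IsFlowMapAt v s u Φ (Z s)} ∩ Icc s T) := by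
    refine isClosed_of_closure_subset fun t₁ ht₁ ↦ ?_
    have ht₁' : t₁ ∈ Icc s T := by
      have := closure_mono inter_subset_right ht₁
      rwa [isClosed_Icc.closure_eq] at this
    obtain ⟨δ, hδ, hδ'⟩ := hloc t₁ ⟨by linarith [ht₁'.1], by linarith [ht₁'.2]⟩
    obtain ⟨t, ht, htS, htI⟩ := mem_closure_iff_nhds.1 ht₁ (Ioo (t₁ - δ) (t₁ + δ))
      (Ioo_mem_nhds (by linarith) (by linarith))
    refine ⟨fun u hu ↦ ?_, ht₁'⟩
    rcases le_or_gt u t with hut | hut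
    · exact htS u ⟨hu.1, hut⟩
    · exact hcomp has htI.1 hut.le (by linarith [hu.2, ht₁'.2]) (htS t ⟨htI.1, le_rfl⟩)
        (hδ' t ht u ⟨by linarith [ht.1], by linarith [hu.2]⟩ hut.le)
  have hsub := hclosed.Icc_subset_of_forall_exists_gt (a := s) (b := T) ?_ ?_
  · exact hsub (right_mem_Icc.2 hsT) T (right_mem_Icc.2 hsT)
  · intro u hu
    obtain rfl : u = s := le_antisymm hu.2 hu.1
    obtain ⟨δ, hδ, hδ'⟩ := hloc u ⟨has, by linarith⟩
    exact hδ' u ⟨by linarith, by linarith⟩ u ⟨by linarith, by linarith⟩ le_rfl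
  · rintro t₁ ⟨ht₁S, ht₁⟩ y hy
    obtain ⟨δ, hδ, hδ'⟩ := hloc t₁ ⟨by linarith [ht₁.1], by linarith [ht₁.2]⟩
    have hy : t₁ < y := hy
    obtain ⟨w, hw1, hw2⟩ := exists_between (lt_min hy (lt_min ht₁.2 (by linarith : t₁ < t₁ + δ)))
    have hwy := hw2.trans_le (min_le_left _ _)
    have hwT := hw2.trans_le ((min_le_right _ _).trans (min_le_left _ _))
    have hwδ := hw2.trans_le ((min_le_right _ _).trans (min_le_right _ _))
    refine ⟨w, fun u hu ↦ ?_, hw1, hwy.le⟩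
    rcases le_or_gt u t₁ with hut | hut
    · exact ht₁S u ⟨hu.1, hut⟩
    · exact hcomp has ht₁.1 hut.le (by linarith [hu.2]) (ht₁S t₁ ⟨ht₁.1, le_rfl⟩)
        (hδ' t₁ ⟨by linarith, by linarith⟩ u ⟨by linarith, by linarith [hu.2]⟩ hut.le)

end ManifoldFlow

end

noncomputable section

namespace ConjugatePoints

open Filter

/-! ### The Riemannian metric in charts -/

section ChartMetric

variable {E : Type*} [NormedAddCommGroup E] [NormedSpace ℝ E]
  {M : Type*} [TopologicalSpace M] [ChartedSpace E M] [IsManifold 𝓘(ℝ, E) ∞ M]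

/-- A tangent space is identified with `E` through the preferred chart at its base point, so
differentiating the inverse of the chart at `c` amounts to changing coordinates from `c` to that
chart. -/
theorem hasMFDerivAt_extChartAt_symm_tangentCoordChange {c : M} {u : E}
    (hu : u ∈ (extChartAt 𝓘(ℝ, E) c).target) :
    HasMFDerivAt 𝓘(ℝ, E) 𝓘(ℝ, E) (extChartAt 𝓘(ℝ, E) c).symm u
      (tangentCoordChange 𝓘(ℝ, E) c ((extChartAt 𝓘(ℝ, E) c).symm u)
        ((extChartAt 𝓘(ℝ, E) c).symm u) : E →L[ℝ] E) := by
  have hc : ContinuousAt (extChartAt 𝓘(ℝ, E) c).symm u := continuousAt_extChartAt_symm'' hu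
  refine ⟨hc, ?_⟩
  have := hasFDerivWithinAt_tangentCoordChange (I := 𝓘(ℝ, E))
    (x := c) (y := (extChartAt 𝓘(ℝ, E) c).symm u) (z := (extChartAt 𝓘(ℝ, E) c).symm u)
    ⟨(extChartAt 𝓘(ℝ, E) c).map_target hu, mem_extChartAt_source _⟩
  rw [(extChartAt 𝓘(ℝ, E) c).right_inv hu] at this
  exact this

theorem hasFDerivAt_extChartAt_comp_symm {c d : M} {u : E}
    (hu : u ∈ (extChartAt 𝓘(ℝ, E) c).target)
    (hd : (extChartAt 𝓘(ℝ, E) c).symm u ∈ (extChartAt 𝓘(ℝ, E) d).source) :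
    HasFDerivAt (fun u ↦ extChartAt 𝓘(ℝ, E) d ((extChartAt 𝓘(ℝ, E) c).symm u))
      (tangentCoordChange 𝓘(ℝ, E) c d ((extChartAt 𝓘(ℝ, E) c).symm u)) u := by
  have := hasFDerivWithinAt_tangentCoordChange (I := 𝓘(ℝ, E))
    (x := c) (y := d) (z := (extChartAt 𝓘(ℝ, E) c).symm u)
    ⟨(extChartAt 𝓘(ℝ, E) c).map_target hu, hd⟩
  rw [(extChartAt 𝓘(ℝ, E) c).right_inv hu] at this
  exact this.hasFDerivAt (by simp)

theorem contDiffAt_extChartAt_comp_symm {c d : M} {u : E}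
    (hu : u ∈ (extChartAt 𝓘(ℝ, E) c).target)
    (hd : (extChartAt 𝓘(ℝ, E) c).symm u ∈ (extChartAt 𝓘(ℝ, E) d).source) :
    ContDiffAt ℝ ∞ (fun u ↦ extChartAt 𝓘(ℝ, E) d ((extChartAt 𝓘(ℝ, E) c).symm u)) u := by
  have := contDiffWithinAt_ext_coord_change (I := 𝓘(ℝ, E)) (n := ∞) d c (y := u)
    (by rw [PartialEquiv.trans_source, PartialEquiv.symm_source]; exact ⟨hu, hd⟩)
  exact this.contDiffAt (by simp)

omit [IsManifold 𝓘(ℝ, E) ∞ M] in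
theorem eventually_mem_transition {c d : M} {u : E}
    (hu : u ∈ (extChartAt 𝓘(ℝ, E) c).target)
    (hd : (extChartAt 𝓘(ℝ, E) c).symm u ∈ (extChartAt 𝓘(ℝ, E) d).source) :
    ∀ᶠ u' in 𝓝 u, u' ∈ (extChartAt 𝓘(ℝ, E) c).target ∧
      (extChartAt 𝓘(ℝ, E) c).symm u' ∈ (extChartAt 𝓘(ℝ, E) d).source :=
  Filter.Eventually.and ((isOpen_extChartAt_target c).mem_nhds hu)
    ((continuousAt_extChartAt_symm'' hu).eventually ((isOpen_extChartAt_source d).mem_nhds hd))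

theorem contDiffAt_tangentCoordChange {c d : M} {u : E}
    (hu : u ∈ (extChartAt 𝓘(ℝ, E) c).target)
    (hd : (extChartAt 𝓘(ℝ, E) c).symm u ∈ (extChartAt 𝓘(ℝ, E) d).source) :
    ContDiffAt ℝ ∞ (fun u ↦ tangentCoordChange 𝓘(ℝ, E) c d ((extChartAt 𝓘(ℝ, E) c).symm u)) u :=
  ((contDiffAt_extChartAt_comp_symm hu hd).fderiv_right (m := ∞) (by simp)).congr_of_eventuallyEq
    ((eventually_mem_transition hu hd).mono fun _ h ↦
      (hasFDerivAt_extChartAt_comp_symm h.1 h.2).fderiv.symm)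

variable [RiemannianBundle (fun x : M ↦ TangentSpace 𝓘(ℝ, E) x)]

/-- The inner product on the tangent space at `y`, on vectors given in the chart at `y`. -/
def innerAt (y : M) (v w : E) : ℝ := inner (E := TangentSpace 𝓘(ℝ, E) y) ℝ v w

omit [IsManifold 𝓘(ℝ, E) ∞ M] in
theorem innerAt_comm (y : M) (v w : E) : innerAt y v w = innerAt y w v :=
  real_inner_comm (F := TangentSpace 𝓘(ℝ, E) y) w v

omit [IsManifold 𝓘(ℝ, E) ∞ M] in
theorem innerAt_self_eq_zero {y : M} {v : E} : innerAt y v v = 0 ↔ v = 0 :=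
  inner_self_eq_zero (𝕜 := ℝ) (E := TangentSpace 𝓘(ℝ, E) y)

omit [IsManifold 𝓘(ℝ, E) ∞ M] in
theorem innerAt_add_left (y : M) (v v' w : E) :
    innerAt y (v + v') w = innerAt y v w + innerAt y v' w :=
  inner_add_left (𝕜 := ℝ) (E := TangentSpace 𝓘(ℝ, E) y) v v' w

omit [IsManifold 𝓘(ℝ, E) ∞ M] in
theorem innerAt_smul_left (y : M) (r : ℝ) (v w : E) :
    innerAt y (r • v) w = r * innerAt y v w :=
  real_inner_smul_left (F := TangentSpace 𝓘(ℝ, E) y) v w r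

/-- The derivative of the inverse of the chart at `c`. -/
def chartSymmDeriv (c : M) (u : E) : E →L[ℝ] E :=
  mfderiv 𝓘(ℝ, E) 𝓘(ℝ, E) (extChartAt 𝓘(ℝ, E) c).symm u

omit [RiemannianBundle (fun x : M ↦ TangentSpace 𝓘(ℝ, E) x)] in
theorem chartSymmDeriv_eq {c : M} {u : E} (hu : u ∈ (extChartAt 𝓘(ℝ, E) c).target) :
    chartSymmDeriv c u = tangentCoordChange 𝓘(ℝ, E) c ((extChartAt 𝓘(ℝ, E) c).symm u)
      ((extChartAt 𝓘(ℝ, E) c).symm u) :=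
  (hasMFDerivAt_extChartAt_symm_tangentCoordChange hu).mfderiv

omit [IsManifold 𝓘(ℝ, E) ∞ M] in
theorem chartMetric_eq_innerAt_chartSymmDeriv (c : M) (u v w : E) :
    chartMetric c u v w = innerAt ((extChartAt 𝓘(ℝ, E) c).symm u)
      (chartSymmDeriv c u v) (chartSymmDeriv c u w) :=
  rfl

theorem chartMetric_eq_innerAt {c : M} {u : E} (hu : u ∈ (extChartAt 𝓘(ℝ, E) c).target) (v w : E) :
    chartMetric c u v w = innerAt ((extChartAt 𝓘(ℝ, E) c).symm u)
      (tangentCoordChange 𝓘(ℝ, E) c ((extChartAt 𝓘(ℝ, E) c).symm u)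
        ((extChartAt 𝓘(ℝ, E) c).symm u) v)
      (tangentCoordChange 𝓘(ℝ, E) c ((extChartAt 𝓘(ℝ, E) c).symm u)
        ((extChartAt 𝓘(ℝ, E) c).symm u) w) := by
  rw [chartMetric_eq_innerAt_chartSymmDeriv, chartSymmDeriv_eq hu]

omit [IsManifold 𝓘(ℝ, E) ∞ M] in
theorem chartMetric_comm (c : M) (u v w : E) : chartMetric c u v w = chartMetric c u w v := by
  simp only [chartMetric_eq_innerAt_chartSymmDeriv, innerAt_comm _ _ (chartSymmDeriv c u w)]

omit [IsManifold 𝓘(ℝ, E) ∞ M] in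
theorem chartMetric_add_left (c : M) (u v v' w : E) :
    chartMetric c u (v + v') w = chartMetric c u v w + chartMetric c u v' w := by
  simp only [chartMetric_eq_innerAt_chartSymmDeriv, map_add, innerAt_add_left]

omit [IsManifold 𝓘(ℝ, E) ∞ M] in
theorem chartMetric_smul_left (c : M) (r : ℝ) (u v w : E) :
    chartMetric c u (r • v) w = r * chartMetric c u v w := by
  simp only [chartMetric_eq_innerAt_chartSymmDeriv, map_smul, innerAt_smul_left]

theorem chartMetric_self_eq_zero {c : M} {u : E} (hu : u ∈ (extChartAt 𝓘(ℝ, E) c).target) {v : E}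
    (h : chartMetric c u v v = 0) : v = 0 := by
  rw [chartMetric_eq_innerAt hu, innerAt_self_eq_zero] at h
  have h1 := (extChartAt 𝓘(ℝ, E) c).map_target hu
  have h2 := mem_extChartAt_source (I := 𝓘(ℝ, E)) ((extChartAt 𝓘(ℝ, E) c).symm u)
  rw [← tangentCoordChange_self (I := 𝓘(ℝ, E)) (x := c) (v := v) h1,
    ← tangentCoordChange_comp (x := (extChartAt 𝓘(ℝ, E) c).symm u) ⟨⟨h1, h2⟩, h1⟩, h, map_zero]

/-- The metric in two charts. -/
theorem chartMetric_transition {c d : M} {u : E} (hu : u ∈ (extChartAt 𝓘(ℝ, E) c).target)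
    (hd : (extChartAt 𝓘(ℝ, E) c).symm u ∈ (extChartAt 𝓘(ℝ, E) d).source) (v w : E) :
    chartMetric d (extChartAt 𝓘(ℝ, E) d ((extChartAt 𝓘(ℝ, E) c).symm u))
      (tangentCoordChange 𝓘(ℝ, E) c d ((extChartAt 𝓘(ℝ, E) c).symm u) v)
      (tangentCoordChange 𝓘(ℝ, E) c d ((extChartAt 𝓘(ℝ, E) c).symm u) w) = chartMetric c u v w := by
  have h1 := (extChartAt 𝓘(ℝ, E) c).map_target hu
  have h2 := mem_extChartAt_source (I := 𝓘(ℝ, E)) ((extChartAt 𝓘(ℝ, E) c).symm u)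
  rw [chartMetric_eq_innerAt hu, chartMetric_eq_innerAt ((extChartAt 𝓘(ℝ, E) d).map_source hd),
    (extChartAt 𝓘(ℝ, E) d).left_inv hd, tangentCoordChange_comp ⟨⟨h1, hd⟩, h2⟩,
    tangentCoordChange_comp ⟨⟨h1, hd⟩, h2⟩]

/-- Vector fields with constant coordinates are smooth sections of the tangent bundle over the
chart, and the metric is smooth on smooth sections. -/
theorem contDiffOn_chartMetric
    [IsContMDiffRiemannianBundle 𝓘(ℝ, E) ∞ E (fun x : M ↦ TangentSpace 𝓘(ℝ, E) x)]
    (c : M) (v w : E) :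
    ContDiffOn ℝ ∞ (fun u ↦ chartMetric c u v w) (extChartAt 𝓘(ℝ, E) c).target := by
  have hsec (v : E) : ContMDiffOn 𝓘(ℝ, E) 𝓘(ℝ, E).tangent ∞
      (fun u ↦ (⟨(extChartAt 𝓘(ℝ, E) c).symm u,
        tangentCoordChange 𝓘(ℝ, E) c ((extChartAt 𝓘(ℝ, E) c).symm u)
          ((extChartAt 𝓘(ℝ, E) c).symm u) v⟩ : TangentBundle 𝓘(ℝ, E) M))
      (extChartAt 𝓘(ℝ, E) c).target := by
    intro u hu
    have h2 := mem_extChartAt_source (I := 𝓘(ℝ, E)) ((extChartAt 𝓘(ℝ, E) c).symm u)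
    refine ContMDiffAt.contMDiffWithinAt (contMDiffAt_totalSpace.2 ⟨?_, ?_⟩)
    · exact (contMDiffOn_extChartAt_symm c).contMDiffAt ((isOpen_extChartAt_target c).mem_nhds hu)
    · refine ((contDiffAt_tangentCoordChange hu h2).clm_apply
        contDiffAt_const).contMDiffAt.congr_of_eventuallyEq ?_ (f := fun u' ↦
          tangentCoordChange 𝓘(ℝ, E) c ((extChartAt 𝓘(ℝ, E) c).symm u)
            ((extChartAt 𝓘(ℝ, E) c).symm u') v)
      filter_upwards [eventually_mem_transition hu h2] with u' hu'
      -- Passing through the preferred chart at the moving point and then to the fixed one is a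
      -- single change of coordinates, which is smooth.
      exact tangentCoordChange_comp ⟨⟨(extChartAt 𝓘(ℝ, E) c).map_target hu'.1,
        mem_extChartAt_source _⟩, hu'.2⟩
  rw [← contMDiffOn_iff_contDiffOn]
  let sec (v : E) (u : E) : TangentSpace 𝓘(ℝ, E) ((extChartAt 𝓘(ℝ, E) c).symm u) :=
    tangentCoordChange 𝓘(ℝ, E) c ((extChartAt 𝓘(ℝ, E) c).symm u)
      ((extChartAt 𝓘(ℝ, E) c).symm u) v
  have := ContMDiffOn.inner_bundle (IB := 𝓘(ℝ, E)) (n := ∞) (F := E)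
    (E := fun x : M ↦ TangentSpace 𝓘(ℝ, E) x)
    (b := (extChartAt 𝓘(ℝ, E) c).symm) (v := sec v) (w := sec w) (hsec v) (hsec w)
  exact this.congr fun u hu ↦ chartMetric_eq_innerAt hu v w

variable [FiniteDimensional ℝ E]

/-- The metric in a chart, as a bilinear map. -/
def chartMetricL (c : M) (u : E) : E →L[ℝ] E →L[ℝ] ℝ :=
  (LinearMap.mk₂ ℝ (chartMetric c u) (chartMetric_add_left c u)
    (fun r v w ↦ chartMetric_smul_left c r u v w)
    (fun v w w' ↦ by rw [chartMetric_comm, chartMetric_add_left, chartMetric_comm c u w,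
      chartMetric_comm c u w'])
    (fun r v w ↦ by rw [chartMetric_comm, chartMetric_smul_left, chartMetric_comm c u w,
      smul_eq_mul])).toContinuousBilinearMap

omit [IsManifold 𝓘(ℝ, E) ∞ M] in
@[simp] theorem chartMetricL_apply (c : M) (u v w : E) :
    chartMetricL c u v w = chartMetric c u v w := rfl

/-- Definiteness gives injectivity, and `E` and its dual have the same finite dimension. -/
theorem isInvertible_chartMetricL {c : M} {u : E} (hu : u ∈ (extChartAt 𝓘(ℝ, E) c).target) :
    (chartMetricL c u).IsInvertible := by
  have hinj : Function.Injective (chartMetricL c u).toLinearMap := by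
    rw [← LinearMap.ker_eq_bot, LinearMap.ker_eq_bot']
    intro v hv
    refine chartMetric_self_eq_zero hu (v := v) ?_
    exact congrArg (fun f : E →L[ℝ] ℝ ↦ f v) hv
  have hdim : finrank ℝ E = finrank ℝ (E →L[ℝ] ℝ) := by
    rw [← (LinearMap.toContinuousLinearMap (𝕜 := ℝ) (E := E) (F' := ℝ)).finrank_eq]
    exact (Subspace.dual_finrank_eq).symm
  refine ⟨(LinearEquiv.ofInjectiveOfFinrankEq _ hinj hdim).toContinuousLinearEquiv, ?_⟩
  ext v w
  rfl

/-- The inverse metric in a chart. -/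
def chartSharp (c : M) (u : E) : (E →L[ℝ] ℝ) →L[ℝ] E := (chartMetricL c u).inverse

theorem chartSharp_chartMetricL {c : M} {u : E} (hu : u ∈ (extChartAt 𝓘(ℝ, E) c).target) (v : E) :
    chartSharp c u (chartMetricL c u v) = v :=
  (isInvertible_chartMetricL hu).inverse_apply_eq.2 rfl

theorem chartMetricL_chartSharp {c : M} {u : E} (hu : u ∈ (extChartAt 𝓘(ℝ, E) c).target)
    (y : E →L[ℝ] ℝ) : chartMetricL c u (chartSharp c u y) = y :=
  ((isInvertible_chartMetricL hu).inverse_apply_eq.1 rfl).symm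

variable [IsContMDiffRiemannianBundle 𝓘(ℝ, E) ∞ E (fun x : M ↦ TangentSpace 𝓘(ℝ, E) x)]

theorem contDiffAt_chartMetricL {c : M} {u : E} (hu : u ∈ (extChartAt 𝓘(ℝ, E) c).target) :
    ContDiffAt ℝ ∞ (chartMetricL c) u := by
  have : ContDiffOn ℝ ∞ (chartMetricL c) (extChartAt 𝓘(ℝ, E) c).target :=
    contDiffOn_clm_apply.2 fun v ↦ contDiffOn_clm_apply.2 fun w ↦ contDiffOn_chartMetric c v w
  exact this.contDiffAt ((isOpen_extChartAt_target c).mem_nhds hu)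

theorem contDiffAt_chartSharp {c : M} {u : E} (hu : u ∈ (extChartAt 𝓘(ℝ, E) c).target) :
    ContDiffAt ℝ ∞ (chartSharp c) u := by
  have : CompleteSpace E := FiniteDimensional.complete ℝ E
  exact (isInvertible_chartMetricL hu).contDiffAt_map_inverse.comp u (contDiffAt_chartMetricL hu)

end ChartMetric

end ConjugatePoints

end

noncomputable section

namespace ConjugatePoints

open Filter

/-! ### The geodesic equation in charts -/

section Acceleration

variable {E : Type*} [NormedAddCommGroup E] [NormedSpace ℝ E] [FiniteDimensional ℝ E]
  {M : Type*} [TopologicalSpace M] [ChartedSpace E M] [IsManifold 𝓘(ℝ, E) ∞ M]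
  [RiemannianBundle (fun x : M ↦ TangentSpace 𝓘(ℝ, E) x)]

local instance : NormedAddCommGroup (E →L[ℝ] E →L[ℝ] ℝ) :=
  ContinuousLinearMap.toNormedAddCommGroup

local instance : NormedSpace ℝ (E →L[ℝ] E →L[ℝ] ℝ) := ContinuousLinearMap.toNormedSpace

local instance : NormedAddCommGroup (E →L[ℝ] E →L[ℝ] E →L[ℝ] ℝ) :=
  ContinuousLinearMap.toNormedAddCommGroup (E := E) (F := E →L[ℝ] E →L[ℝ] ℝ)

local instance : NormedSpace ℝ (E →L[ℝ] E →L[ℝ] E →L[ℝ] ℝ) :=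
  ContinuousLinearMap.toNormedSpace (E := E) (F := E →L[ℝ] E →L[ℝ] ℝ)

/-- The 1-form `z ↦ christoffel c u w w z`. -/
def christoffelForm (c : M) (u w : E) : E →L[ℝ] ℝ :=
  fderiv ℝ (chartMetricL c) u w w
    - (1 / 2 : ℝ) • ((fderiv ℝ (chartMetricL c) u).flip w).flip w

/-- The acceleration, in the chart at `c`, of a geodesic at the point `u` with velocity `w`. -/
def geodesicAcc (c : M) (u w : E) : E := -chartSharp c u (christoffelForm c u w)

variable [IsContMDiffRiemannianBundle 𝓘(ℝ, E) ∞ E (fun x : M ↦ TangentSpace 𝓘(ℝ, E) x)]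

theorem hasFDerivAt_chartMetricL {c : M} {u : E} (hu : u ∈ (extChartAt 𝓘(ℝ, E) c).target) :
    HasFDerivAt (chartMetricL c) (fderiv ℝ (chartMetricL c) u) u :=
  ((contDiffAt_chartMetricL hu).differentiableAt (by simp)).hasFDerivAt

theorem fderiv_chartMetric {c : M} {u : E} (hu : u ∈ (extChartAt 𝓘(ℝ, E) c).target) (v w z : E) :
    fderiv ℝ (fun u' ↦ chartMetric c u' v w) u z = fderiv ℝ (chartMetricL c) u z v w := by
  have h := ((hasFDerivAt_chartMetricL hu).clm_apply (hasFDerivAt_const v u)).clm_apply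
    (hasFDerivAt_const w u)
  have e : HasFDerivAt (fun u' ↦ chartMetric c u' v w) _ u := h
  rw [e.fderiv]
  simp

/-- When the first two arguments coincide, so do the first two terms of the Christoffel symbol,
which cancels their factor 1/2. -/
theorem christoffelForm_apply {c : M} {u : E} (hu : u ∈ (extChartAt 𝓘(ℝ, E) c).target) (w z : E) :
    christoffelForm c u w z = christoffel c u w w z := by
  simp only [christoffelForm, christoffel, fderiv_chartMetric hu]
  simp
  ring

/-- The geodesic equation, solved for the acceleration. -/
theorem geodesic_equation_iff {c : M} {u : E} (hu : u ∈ (extChartAt 𝓘(ℝ, E) c).target) (a w : E) :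
    (∀ z, chartMetric c u a z + christoffel c u w w z = 0) ↔ a = geodesicAcc c u w := by
  constructor
  · intro h
    have : chartMetricL c u a = -christoffelForm c u w := by
      ext z
      rw [neg_apply, christoffelForm_apply hu, chartMetricL_apply]
      linarith [h z]
    rw [geodesicAcc, ← map_neg, ← this, chartSharp_chartMetricL hu]
  · rintro rfl z
    rw [← chartMetricL_apply, geodesicAcc, map_neg, chartMetricL_chartSharp hu,
      ← christoffelForm_apply hu]
    simp

theorem contDiffAt_geodesicAcc {c : M} {u : E} (hu : u ∈ (extChartAt 𝓘(ℝ, E) c).target) (w : E) :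
    ContDiffAt ℝ ∞ (fun p : E × E ↦ geodesicAcc c p.1 p.2) (u, w) := by
  have hmem : ∀ᶠ p : E × E in 𝓝 (u, w), p.1 ∈ (extChartAt 𝓘(ℝ, E) c).target :=
    continuousAt_fst.eventually ((isOpen_extChartAt_target c).mem_nhds hu)
  have hD : ContDiffOn ℝ ∞ (fun p : E × E ↦ fderiv ℝ (chartMetricL c) p.1)
      (Prod.fst ⁻¹' (extChartAt 𝓘(ℝ, E) c).target) := fun p hp ↦
    (((contDiffAt_chartMetricL hp).fderiv_right (m := ∞) (by simp)).comp p
      contDiffAt_fst).contDiffWithinAt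
  have h1 : ContDiffOn ℝ ∞ (fun p : E × E ↦ christoffelForm c p.1 p.2)
      (Prod.fst ⁻¹' (extChartAt 𝓘(ℝ, E) c).target) := by
    refine contDiffOn_clm_apply.2 fun z ↦ ?_
    simp only [christoffelForm, sub_apply, smul_apply,
      ContinuousLinearMap.flip_apply]
    exact (((hD.clm_apply contDiffOn_snd).clm_apply contDiffOn_snd).clm_apply
      contDiffOn_const).sub ((((hD.clm_apply contDiffOn_const).clm_apply
        contDiffOn_snd).clm_apply contDiffOn_snd).const_smul _)
  have h2 : ContDiffAt ℝ ∞ (fun p : E × E ↦ chartSharp c p.1) (u, w) :=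
    ContDiffAt.comp (g := chartSharp c) (f := Prod.fst) (u, w) (contDiffAt_chartSharp hu)
      contDiffAt_fst
  exact (h2.clm_apply (h1.contDiffAt hmem)).neg

/-- The acceleration of a geodesic in two charts. -/
theorem geodesicAcc_transition {c d : M} {u : E} (hu : u ∈ (extChartAt 𝓘(ℝ, E) c).target)
    (hd : (extChartAt 𝓘(ℝ, E) c).symm u ∈ (extChartAt 𝓘(ℝ, E) d).source) (w : E) :
    geodesicAcc d (extChartAt 𝓘(ℝ, E) d ((extChartAt 𝓘(ℝ, E) c).symm u))
        (tangentCoordChange 𝓘(ℝ, E) c d ((extChartAt 𝓘(ℝ, E) c).symm u) w)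
      = fderiv ℝ (fun u ↦ tangentCoordChange 𝓘(ℝ, E) c d ((extChartAt 𝓘(ℝ, E) c).symm u)) u w w
        + tangentCoordChange 𝓘(ℝ, E) c d ((extChartAt 𝓘(ℝ, E) c).symm u) (geodesicAcc c u w) := by
  have h1 := (extChartAt 𝓘(ℝ, E) c).map_target hu
  set y := (extChartAt 𝓘(ℝ, E) c).symm u with hy
  set u' := extChartAt 𝓘(ℝ, E) d y with hu'
  have hu'd : u' ∈ (extChartAt 𝓘(ℝ, E) d).target := (extChartAt 𝓘(ℝ, E) d).map_source hd
  set T := fun u ↦ tangentCoordChange 𝓘(ℝ, E) c d ((extChartAt 𝓘(ℝ, E) c).symm u) with hT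
  have hTy : tangentCoordChange 𝓘(ℝ, E) c d y = T u := rfl
  rw [hTy]
  have hτ := hasFDerivAt_extChartAt_comp_symm hu hd
  have hTd : HasFDerivAt T (fderiv ℝ T u) u :=
    ((contDiffAt_tangentCoordChange hu hd).differentiableAt (by simp)).hasFDerivAt
  -- the second derivative of the change of coordinates is symmetric
  have hsymm (a b : E) : fderiv ℝ T u a b = fderiv ℝ T u b a := by
    refine second_derivative_symmetric_of_eventually
      (f := fun u ↦ extChartAt 𝓘(ℝ, E) d ((extChartAt 𝓘(ℝ, E) c).symm u)) (f' := T) ?_ hTd a b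
    filter_upwards [eventually_mem_transition hu hd] with v hv
    exact hasFDerivAt_extChartAt_comp_symm hv.1 hv.2
  -- differentiate the transformation law of the metric
  have hdG (a v z : E) : fderiv ℝ (chartMetricL c) u a v z
      = fderiv ℝ (chartMetricL d) u' (T u a) (T u v) (T u z)
        + chartMetric d u' (fderiv ℝ T u a v) (T u z)
        + chartMetric d u' (T u v) (fderiv ℝ T u a z) := by
    have e1 : (fun v' ↦ chartMetricL d (extChartAt 𝓘(ℝ, E) d ((extChartAt 𝓘(ℝ, E) c).symm v'))
        (T v' v) (T v' z)) =ᶠ[𝓝 u] fun v' ↦ chartMetric c v' v z := by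
      filter_upwards [eventually_mem_transition hu hd] with v' hv'
      exact chartMetric_transition hv'.1 hv'.2 v z
    have e2 := (((hasFDerivAt_chartMetricL hu'd).comp u hτ).clm_apply
      (hTd.clm_apply (hasFDerivAt_const v u))).clm_apply (hTd.clm_apply (hasFDerivAt_const z u))
    rw [← fderiv_chartMetric hu, ← e1.fderiv_eq]
    refine (congrArg (· a) e2.fderiv).trans ?_
    simp only [add_apply, ContinuousLinearMap.comp_apply, ContinuousLinearMap.flip_apply,
      zero_apply, map_zero, zero_add, Function.comp_apply, chartMetricL_apply]
    change chartMetric d u' (T u v) (fderiv ℝ T u a z) + (chartMetric d u' (fderiv ℝ T u a v) (T u z)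
      + fderiv ℝ (chartMetricL d) u' (T u a) (T u v) (T u z)) = _
    ring
  symm
  refine (geodesic_equation_iff hu'd _ _).1 fun z' ↦ ?_
  -- The change of coordinates is invertible, so it suffices to test on vectors `T u z`; there the
  -- claim can be compared with the geodesic equation in the chart at `c`.
  obtain ⟨z, rfl⟩ : ∃ z, T u z = z' := by
    refine ⟨tangentCoordChange 𝓘(ℝ, E) d c y z', ?_⟩
    exact (tangentCoordChange_comp ⟨⟨hd, h1⟩, hd⟩).trans (tangentCoordChange_self hd)
  rw [chartMetric_add_left, ← christoffelForm_apply hu'd]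
  have hc := (geodesic_equation_iff hu (geodesicAcc c u w) w).2 rfl z
  rw [← christoffelForm_apply hu, ← chartMetric_transition hu hd] at hc
  simp only [christoffelForm, sub_apply, smul_apply,
    ContinuousLinearMap.flip_apply, hdG, smul_eq_mul] at hc ⊢
  rw [← hy, ← hu', hTy] at hc
  -- By symmetry the terms pairing `T u w` with a derivative of `T` cancel; only the pairing of
  -- `fderiv ℝ T u w w` with `T u z` survives.
  rw [hsymm z w, chartMetric_comm d u' (T u w)] at hc
  linarith

end Acceleration

end ConjugatePoints

end

noncomputable section

namespace ConjugatePoints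

open Filter

/-! ### The geodesic spray -/

section Curves

variable {E : Type*} [NormedAddCommGroup E] [NormedSpace ℝ E]
  {M : Type*} [TopologicalSpace M] [ChartedSpace E M] [IsManifold 𝓘(ℝ, E) ∞ M]

/-- The velocity of a curve, read in another chart. -/
theorem hasDerivAt_extChartAt_comp {γ : ℝ → M} {s : ℝ} {c : M} {ξ : TangentSpace 𝓘(ℝ, E) (γ s)}
    (hc : γ s ∈ (extChartAt 𝓘(ℝ, E) c).source)
    (h : HasMFDerivAt 𝓘(ℝ, ℝ) 𝓘(ℝ, E) γ s ((1 : ℝ →L[ℝ] ℝ).smulRight ξ)) :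
    HasDerivAt (fun r ↦ extChartAt 𝓘(ℝ, E) c (γ r))
      (tangentCoordChange 𝓘(ℝ, E) (γ s) c (γ s) ξ) s := by
  obtain ⟨h1, h2⟩ := hasMFDerivAt_curve_iff.1 h
  have hs := mem_extChartAt_source (I := 𝓘(ℝ, E)) (γ s)
  have hτ := hasFDerivAt_extChartAt_comp_symm (c := γ s) (d := c) (u := extChartAt 𝓘(ℝ, E) (γ s) (γ s))
    ((extChartAt 𝓘(ℝ, E) (γ s)).map_source hs) (by rwa [(extChartAt 𝓘(ℝ, E) (γ s)).left_inv hs])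
  rw [(extChartAt 𝓘(ℝ, E) (γ s)).left_inv hs] at hτ
  refine (hτ.comp_hasDerivAt s h2).congr_of_eventuallyEq ?_
  filter_upwards [h1.eventually ((isOpen_extChartAt_source (γ s)).mem_nhds hs)] with r hr
  simp only [Function.comp_apply, (extChartAt 𝓘(ℝ, E) (γ s)).left_inv hr]

/-- The vector of an element of the tangent bundle, in the chart at its base point. -/
def fiberVec (z : TangentBundle 𝓘(ℝ, E) M) : E := z.2

theorem extChartAt_tangentBundle (z₀ z : TangentBundle 𝓘(ℝ, E) M) :
    extChartAt 𝓘(ℝ, E).tangent z₀ z = (extChartAt 𝓘(ℝ, E) z₀.proj z.proj,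
      tangentCoordChange 𝓘(ℝ, E) z.proj z₀.proj z.proj (fiberVec z)) := rfl

theorem mem_extChartAt_tangentBundle_source (z₀ z : TangentBundle 𝓘(ℝ, E) M) :
    z ∈ (extChartAt 𝓘(ℝ, E).tangent z₀).source ↔
      z.proj ∈ (extChartAt 𝓘(ℝ, E) z₀.proj).source := by
  rw [extChartAt_source, extChartAt_source, TangentBundle.mem_chart_source_iff]

/-- The change of coordinates of the tangent bundle. -/
theorem extChartAt_tangentBundle_comp_symm {z₀ z : TangentBundle 𝓘(ℝ, E) M}
    (hz : z.proj ∈ (extChartAt 𝓘(ℝ, E) z₀.proj).source) :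
    (fun p : E × E ↦ extChartAt 𝓘(ℝ, E).tangent z₀ ((extChartAt 𝓘(ℝ, E).tangent z).symm p))
      =ᶠ[𝓝 (extChartAt 𝓘(ℝ, E).tangent z z)]
    fun p ↦ (extChartAt 𝓘(ℝ, E) z₀.proj ((extChartAt 𝓘(ℝ, E) z.proj).symm p.1),
      tangentCoordChange 𝓘(ℝ, E) z.proj z₀.proj ((extChartAt 𝓘(ℝ, E) z.proj).symm p.1) p.2) := by
  have h1 : (extChartAt 𝓘(ℝ, E).tangent z).target ∈ 𝓝 (extChartAt 𝓘(ℝ, E).tangent z z) :=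
    extChartAt_target_mem_nhds z
  have h2 := continuousAt_extChartAt_symm (I := 𝓘(ℝ, E).tangent) z
  have h3 : ∀ᶠ p in 𝓝 (extChartAt 𝓘(ℝ, E).tangent z z),
      (extChartAt 𝓘(ℝ, E).tangent z).symm p ∈ (extChartAt 𝓘(ℝ, E).tangent z₀).source := by
    refine h2.eventually ((isOpen_extChartAt_source z₀).mem_nhds ?_)
    rw [(extChartAt 𝓘(ℝ, E).tangent z).left_inv (mem_extChartAt_source z)]
    exact (mem_extChartAt_tangentBundle_source _ _).2 hz
  filter_upwards [h1, h3] with p hp1 hp3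
  have hp2 := (extChartAt 𝓘(ℝ, E).tangent z).map_target hp1
  have hp4 := (extChartAt 𝓘(ℝ, E).tangent z).right_inv hp1
  generalize (extChartAt 𝓘(ℝ, E).tangent z).symm p = ζ at *
  rw [mem_extChartAt_tangentBundle_source] at hp2 hp3
  subst hp4
  simp only [extChartAt_tangentBundle, (extChartAt 𝓘(ℝ, E) z.proj).left_inv hp2]
  rw [tangentCoordChange_comp ⟨⟨mem_extChartAt_source _, hp2⟩, hp3⟩]

/-- The tangent bundle changes coordinates by `(u, w) ↦ (τ u, Dτ_u w)`. Differentiating the second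
entry in `u` produces the second-derivative term. -/
theorem tangentCoordChange_tangentBundle {z₀ z : TangentBundle 𝓘(ℝ, E) M}
    (hz : z.proj ∈ (extChartAt 𝓘(ℝ, E) z₀.proj).source) (a b : E) :
    tangentCoordChange 𝓘(ℝ, E).tangent z z₀ z (a, b)
      = (tangentCoordChange 𝓘(ℝ, E) z.proj z₀.proj z.proj a,
        fderiv ℝ (fun u ↦ tangentCoordChange 𝓘(ℝ, E) z.proj z₀.proj
          ((extChartAt 𝓘(ℝ, E) z.proj).symm u)) (extChartAt 𝓘(ℝ, E) z.proj z.proj) a (fiberVec z)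
        + tangentCoordChange 𝓘(ℝ, E) z.proj z₀.proj z.proj b) := by
  have hs := mem_extChartAt_source (I := 𝓘(ℝ, E)) z.proj
  have hu := (extChartAt 𝓘(ℝ, E) z.proj).map_source hs
  have hd : (extChartAt 𝓘(ℝ, E) z.proj).symm (extChartAt 𝓘(ℝ, E) z.proj z.proj)
      ∈ (extChartAt 𝓘(ℝ, E) z₀.proj).source := by
    rwa [(extChartAt 𝓘(ℝ, E) z.proj).left_inv hs]
  have hτ := hasFDerivAt_extChartAt_comp_symm hu hd
  have hT := ((contDiffAt_tangentCoordChange hu hd).differentiableAt (by simp)).hasFDerivAt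
  have hz2 : extChartAt 𝓘(ℝ, E).tangent z z = (extChartAt 𝓘(ℝ, E) z.proj z.proj, fiberVec z) := by
    rw [extChartAt_tangentBundle, tangentCoordChange_self hs]
  have h1 := (HasFDerivAt.comp (f := Prod.fst)
      (extChartAt 𝓘(ℝ, E) z.proj z.proj, fiberVec z) hτ hasFDerivAt_fst).prodMk
    ((HasFDerivAt.comp (f := Prod.fst)
      (extChartAt 𝓘(ℝ, E) z.proj z.proj, fiberVec z) hT hasFDerivAt_fst).clm_apply hasFDerivAt_snd)
  rw [tangentCoordChange_def]
  have hr : range 𝓘(ℝ, E).tangent = univ := ModelWithCorners.Boundaryless.range_eq_univ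
  rw [hr, fderivWithin_univ]
  refine (congrArg (fun L : E × E →L[ℝ] E × E ↦ L (a, b))
    (extChartAt_tangentBundle_comp_symm hz).fderiv_eq).trans ?_
  rw [hz2]
  refine (congrArg (fun L : E × E →L[ℝ] E × E ↦ L (a, b)) h1.fderiv).trans ?_
  simp only [ContinuousLinearMap.prod_apply, ContinuousLinearMap.comp_apply,
    ContinuousLinearMap.coe_fst', add_apply, ContinuousLinearMap.coe_snd',
    ContinuousLinearMap.flip_apply, Function.comp_apply, (extChartAt 𝓘(ℝ, E) z.proj).left_inv hs]
  rw [add_comm]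

end Curves

section Spray

variable {E : Type*} [NormedAddCommGroup E] [NormedSpace ℝ E] [FiniteDimensional ℝ E]
  {M : Type*} [TopologicalSpace M] [ChartedSpace E M] [IsManifold 𝓘(ℝ, E) ∞ M]
  [RiemannianBundle (fun x : M ↦ TangentSpace 𝓘(ℝ, E) x)]

/-- The geodesic spray, as a vector field on the tangent bundle. -/
def geodesicSpray (z : TangentBundle 𝓘(ℝ, E) M) : TangentSpace 𝓘(ℝ, E).tangent z :=
  ((fiberVec z, geodesicAcc z.proj (extChartAt 𝓘(ℝ, E) z.proj z.proj) (fiberVec z)) : E × E)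

variable [IsContMDiffRiemannianBundle 𝓘(ℝ, E) ∞ E (fun x : M ↦ TangentSpace 𝓘(ℝ, E) x)]

/-- In the fixed chart at `z₀` the spray reads `(u, w) ↦ (w, geodesicAcc u w)`: the inhomogeneous
term of `geodesicAcc_transition` is exactly the second-derivative term of the coordinate change on
the tangent bundle. -/
theorem contMDiff_geodesicSpray :
    ContMDiff 𝓘(ℝ, E).tangent 𝓘(ℝ, E).tangent.tangent ∞
      (fun z ↦ (⟨z, geodesicSpray z⟩ :
        TangentBundle 𝓘(ℝ, E).tangent (TangentBundle 𝓘(ℝ, E) M))) := by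
  intro z₀
  refine (contMDiffAt_section z₀).2 ?_
  have hs₀ := mem_extChartAt_source (I := 𝓘(ℝ, E)) z₀.proj
  have hu₀ := (extChartAt 𝓘(ℝ, E) z₀.proj).map_source hs₀
  have h1 : ContDiffAt ℝ ∞ (fun p : E × E ↦ (p.2, geodesicAcc z₀.proj p.1 p.2))
      (extChartAt 𝓘(ℝ, E).tangent z₀ z₀) :=
    contDiffAt_snd.prodMk (contDiffAt_geodesicAcc hu₀ _)
  have h2 := h1.contMDiffAt.comp z₀ (contMDiffAt_extChartAt (I := 𝓘(ℝ, E).tangent) (n := ∞))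
  refine h2.congr_of_eventuallyEq ?_
  filter_upwards [(isOpen_extChartAt_source (I := 𝓘(ℝ, E).tangent) z₀).mem_nhds
    (mem_extChartAt_source z₀)] with z hz
  rw [mem_extChartAt_tangentBundle_source] at hz
  have hs := mem_extChartAt_source (I := 𝓘(ℝ, E)) z.proj
  have hu := (extChartAt 𝓘(ℝ, E) z.proj).map_source hs
  have := geodesicAcc_transition hu (d := z₀.proj)
    (by rwa [(extChartAt 𝓘(ℝ, E) z.proj).left_inv hs]) (fiberVec z)
  rw [(extChartAt 𝓘(ℝ, E) z.proj).left_inv hs] at this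
  refine (tangentCoordChange_tangentBundle hz _ _).trans ?_
  simp only [Function.comp_apply, extChartAt_tangentBundle]
  exact Prod.ext rfl this.symm

/-- The curve in the tangent bundle given by a curve and its velocity. -/
def velocityLift (γ : ℝ → M) (t : ℝ) : TangentBundle 𝓘(ℝ, E) M :=
  ⟨γ t, mfderiv 𝓘(ℝ, ℝ) 𝓘(ℝ, E) γ t (1 : ℝ)⟩

omit [FiniteDimensional ℝ E] [IsManifold 𝓘(ℝ, E) ∞ M]
  [RiemannianBundle (fun x : M ↦ TangentSpace 𝓘(ℝ, E) x)]
  [IsContMDiffRiemannianBundle 𝓘(ℝ, E) ∞ E (fun x : M ↦ TangentSpace 𝓘(ℝ, E) x)] in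
theorem velocityLift_eq {γ : ℝ → M} {t : ℝ} {ξ : TangentSpace 𝓘(ℝ, E) (γ t)}
    (h : HasMFDerivAt 𝓘(ℝ, ℝ) 𝓘(ℝ, E) γ t ((1 : ℝ →L[ℝ] ℝ).smulRight ξ)) :
    velocityLift γ t = ⟨γ t, ξ⟩ := by
  rw [velocityLift, h.mfderiv]
  congr 1
  exact one_smul ℝ ξ

omit [IsContMDiffRiemannianBundle 𝓘(ℝ, E) ∞ E (fun x : M ↦ TangentSpace 𝓘(ℝ, E) x)]
  [FiniteDimensional ℝ E] [IsManifold 𝓘(ℝ, E) ∞ M] in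
theorem IsGeodesicOn.hasMFDerivAt {γ : ℝ → M} {J : Set ℝ} (h : IsGeodesicOn (E := E) γ J) {t : ℝ}
    (ht : t ∈ J) : ∃ ξ : TangentSpace 𝓘(ℝ, E) (γ t),
      HasMFDerivAt 𝓘(ℝ, ℝ) 𝓘(ℝ, E) γ t ((1 : ℝ →L[ℝ] ℝ).smulRight ξ) :=
  ⟨_, hasMFDerivAt_curve_iff.2 ⟨(h t ht).1, (h t ht).2.1.self_of_nhds.hasDerivAt⟩⟩

/-- The velocity of a geodesic is an integral curve of the geodesic spray. -/
theorem IsGeodesicOn.isMIntegralCurveOn {γ : ℝ → M} {J : Set ℝ} (hJ : IsOpen J)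
    (h : IsGeodesicOn (E := E) γ J) :
    IsMIntegralCurveOn (I := 𝓘(ℝ, E).tangent) (velocityLift γ) geodesicSpray J := by
  intro t ht
  apply HasMFDerivAt.hasMFDerivWithinAt
  obtain ⟨hc, hd, hdd, heq⟩ := h t ht
  have hs := mem_extChartAt_source (I := 𝓘(ℝ, E)) (γ t)
  have hu := (extChartAt 𝓘(ℝ, E) (γ t)).map_source hs
  have hacc := (geodesic_equation_iff hu _ _).1 heq
  -- In one fixed chart, the fibre coordinate of the lift is the derivative of the position, so the
  -- geodesic equation becomes first order.
  have hev : ∀ᶠ s in 𝓝 t, extChartAt 𝓘(ℝ, E).tangent (velocityLift (E := E) γ t)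
        (velocityLift (E := E) γ s)
      = (extChartAt 𝓘(ℝ, E) (γ t) (γ s), deriv (fun s ↦ extChartAt 𝓘(ℝ, E) (γ t) (γ s)) s) := by
    filter_upwards [hJ.mem_nhds ht, hc.eventually ((isOpen_extChartAt_source (γ t)).mem_nhds hs)]
      with s hsJ hss
    obtain ⟨ξ, hξ⟩ := h.hasMFDerivAt hsJ
    rw [(hasDerivAt_extChartAt_comp hss hξ).deriv, velocityLift_eq hξ]
    rfl
  have hv : velocityLift γ t = ⟨γ t, deriv (fun s ↦ extChartAt 𝓘(ℝ, E) (γ t) (γ s)) t⟩ :=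
    velocityLift_eq (hasMFDerivAt_curve_iff.2 ⟨hc, hd.self_of_nhds.hasDerivAt⟩)
  rw [hasMFDerivAt_curve_iff]
  refine ⟨?_, ?_⟩
  · refine (FiberBundle.continuousAt_totalSpace E _).2 ⟨hc, ?_⟩
    refine hdd.continuousAt.congr ?_
    filter_upwards [hev] with s hs'
    exact (congrArg Prod.snd hs').symm
  · have h1 := (hd.self_of_nhds.hasDerivAt).prodMk hdd.hasDerivAt
    refine (h1.congr_of_eventuallyEq hev).congr_deriv ?_
    rw [hacc, hv]
    rfl

/-- Integral curves of the geodesic spray project to geodesics. -/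
theorem isGeodesicOn_of_isMIntegralCurveOn {Z : ℝ → TangentBundle 𝓘(ℝ, E) M} {J : Set ℝ}
    (hJ : IsOpen J) (h : IsMIntegralCurveOn (I := 𝓘(ℝ, E).tangent) Z geodesicSpray J) :
    IsGeodesicOn (E := E) (fun t ↦ (Z t).proj) J ∧
      ∀ t ∈ J, velocityLift (fun t ↦ (Z t).proj) t = Z t := by
  have hZ : ∀ t ∈ J, ContinuousAt Z t ∧
      HasDerivAt (F := E × E) (fun s ↦ extChartAt 𝓘(ℝ, E).tangent (Z t) (Z s))
        (geodesicSpray (Z t)) t := fun t ht ↦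
    hasMFDerivAt_curve_iff.1 ((h t ht).hasMFDerivAt (hJ.mem_nhds ht))
  have hcont : ∀ t ∈ J, ContinuousAt (fun t ↦ (Z t).proj) t := fun t ht ↦
    (FiberBundle.continuous_proj E _).continuousAt.comp (hZ t ht).1
  have hder : ∀ t ∈ J, HasMFDerivAt 𝓘(ℝ, ℝ) 𝓘(ℝ, E) (fun t ↦ (Z t).proj) t
      ((1 : ℝ →L[ℝ] ℝ).smulRight (Z t).2) := fun t ht ↦
    hasMFDerivAt_curve_iff.2 ⟨hcont t ht, (hZ t ht).2.fst⟩
  refine ⟨fun t ht ↦ ⟨hcont t ht, ?_⟩, fun t ht ↦ velocityLift_eq (hder t ht)⟩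
  have hs := mem_extChartAt_source (I := 𝓘(ℝ, E)) (Z t).proj
  have hu := (extChartAt 𝓘(ℝ, E) (Z t).proj).map_source hs
  have hev : ∀ᶠ s in 𝓝 t, HasDerivAt (fun s ↦ extChartAt 𝓘(ℝ, E) (Z t).proj (Z s).proj)
      (tangentCoordChange 𝓘(ℝ, E) (Z s).proj (Z t).proj (Z s).proj (fiberVec (Z s))) s := by
    filter_upwards [hJ.mem_nhds ht,
      (hcont t ht).eventually ((isOpen_extChartAt_source (Z t).proj).mem_nhds hs)] with s hsJ hss
    exact hasDerivAt_extChartAt_comp hss (hder s hsJ)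
  have hdd : HasDerivAt (deriv (fun s ↦ extChartAt 𝓘(ℝ, E) (Z t).proj (Z s).proj))
      (geodesicAcc (Z t).proj (extChartAt 𝓘(ℝ, E) (Z t).proj (Z t).proj) (fiberVec (Z t))) t :=
    HasDerivAt.congr_of_eventuallyEq (hZ t ht).2.snd (hev.mono fun s hs' ↦ hs'.deriv)
  refine ⟨hev.mono fun s hs' ↦ hs'.differentiableAt, hdd.differentiableAt, ?_⟩
  refine (geodesic_equation_iff hu _ _).2 ?_
  rw [hdd.deriv, (hev.self_of_nhds).deriv, tangentCoordChange_self hs]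

end Spray

end ConjugatePoints

end

noncomputable section

namespace ConjugatePoints

open Filter

/-! ### The exponential map -/

/-- The total space of a fibre bundle with Hausdorff base and fibre is Hausdorff. -/
theorem t2Space_totalSpace {B F : Type*} [TopologicalSpace B] [TopologicalSpace F] [T2Space B]
    [T2Space F] (V : B → Type*) [TopologicalSpace (TotalSpace F V)] [∀ b, TopologicalSpace (V b)]
    [FiberBundle F V] : T2Space (TotalSpace F V) := by
  refine ⟨fun z w hzw ↦ ?_⟩
  have hπ : Continuous (π F V) := FiberBundle.continuous_proj F V
  by_cases h : z.proj = w.proj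
  · let e := trivializationAt F V z.proj
    have hz : z ∈ e.source := FiberBundle.mem_trivializationAt_proj_source
    have hw : w ∈ e.source := by
      rw [e.mem_source, ← h]; exact FiberBundle.mem_baseSet_trivializationAt' _
    have hne : e z ≠ e w := fun h' ↦ hzw (e.injOn hz hw h')
    obtain ⟨U, U', hU, hU', hzU, hwU', hd⟩ := t2_separation hne
    exact ⟨e.source ∩ e ⁻¹' U, e.source ∩ e ⁻¹' U',
      e.toOpenPartialHomeomorph.isOpen_inter_preimage hU,
      e.toOpenPartialHomeomorph.isOpen_inter_preimage hU', ⟨hz, hzU⟩, ⟨hw, hwU'⟩,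
      (hd.preimage e).mono inter_subset_right inter_subset_right⟩
  · obtain ⟨U, U', hU, hU', hzU, hwU', hd⟩ := t2_separation h
    exact ⟨_, _, hU.preimage hπ, hU'.preimage hπ, hzU, hwU', hd.preimage _⟩

section Exp

variable {E : Type*} [NormedAddCommGroup E] [NormedSpace ℝ E]
  {M : Type*} [TopologicalSpace M] [ChartedSpace E M]

theorem tangentBundle_mk_congr {x y : M} (h : x = y) (v : E) :
    (⟨x, v⟩ : TangentBundle 𝓘(ℝ, E) M) = ⟨y, v⟩ := by
  subst h; rfl

variable [RiemannianBundle (fun x : M ↦ TangentSpace 𝓘(ℝ, E) x)]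

theorem christoffel_smul_smul (c : M) (u v z : E) (r : ℝ) :
    christoffel c u (r • v) (r • v) z = r ^ 2 * christoffel c u v v z := by
  have h1 : (fun u' ↦ chartMetric c u' (r • v) z) = fun u' ↦ r * chartMetric c u' v z := by
    ext u'; rw [chartMetric_smul_left]
  have h2 : (fun u' ↦ chartMetric c u' (r • v) (r • v))
      = fun u' ↦ r ^ 2 * chartMetric c u' v v := by
    ext u'; rw [chartMetric_smul_left, chartMetric_comm, chartMetric_smul_left]; ring
  have h3 (a : ℝ) (g : E → ℝ) : fderiv ℝ (fun u' ↦ a * g u') u = a • fderiv ℝ g u :=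
    congrFun (fderiv_const_smul_field (𝕜 := ℝ) (f := g) a) u
  simp only [christoffel, h1, h2, map_smul, h3]
  simp only [smul_apply, smul_eq_mul]
  ring

/-- Reparametrization of geodesics. -/
theorem IsGeodesicOn.comp_mul {γ : ℝ → M} {J : Set ℝ} (h : IsGeodesicOn (E := E) γ J) (r : ℝ) :
    IsGeodesicOn (E := E) (fun t ↦ γ (r * t)) ((r * ·) ⁻¹' J) := by
  intro t ht
  obtain ⟨hc, hd, hdd, heq⟩ := h (r * t) ht
  have hm : ContinuousAt (fun t : ℝ ↦ r * t) t := by fun_prop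
  have hmd (s : ℝ) : HasDerivAt (fun t : ℝ ↦ r * t) r s := by
    simpa using (hasDerivAt_id s).const_mul r
  have hev : ∀ᶠ s in 𝓝 t, HasDerivAt (fun s ↦ extChartAt 𝓘(ℝ, E) (γ (r * t)) (γ (r * s)))
      (r • deriv (fun s ↦ extChartAt 𝓘(ℝ, E) (γ (r * t)) (γ s)) (r * s)) s := by
    filter_upwards [hm.eventually hd] with s hs
    exact hs.hasDerivAt.scomp s (hmd s)
  have hdd' : HasDerivAt (deriv fun s ↦ extChartAt 𝓘(ℝ, E) (γ (r * t)) (γ (r * s)))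
      (r • (r • deriv (deriv fun s ↦ extChartAt 𝓘(ℝ, E) (γ (r * t)) (γ s)) (r * t))) t := by
    have := (hdd.hasDerivAt.scomp t (hmd t)).const_smul r
    exact HasDerivAt.congr_of_eventuallyEq this (hev.mono fun s hs ↦ hs.deriv)
  refine ⟨ContinuousAt.comp (f := fun t : ℝ ↦ r * t) hc hm,
    hev.mono fun s hs ↦ hs.differentiableAt, hdd'.differentiableAt, fun z ↦ ?_⟩
  rw [hdd'.deriv, hev.self_of_nhds.deriv, christoffel_smul_smul, chartMetric_smul_left,
    chartMetric_smul_left]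
  linear_combination r ^ 2 * heq z

/-- This identifies `exp_x (s w)` with `γ s`, for `s` of either sign and also for `s = 0`. -/
theorem isGeodesicFrom_comp_mul {γ : ℝ → M} {a b : ℝ} (h : IsGeodesicOn (E := E) γ (Ioo a b))
    (ha : a < 0) (hb : 0 < b) {x : M} {w : TangentSpace 𝓘(ℝ, E) x}
    (h0 : velocityLift γ 0 = ⟨x, w⟩) {s : ℝ} (hs : s ∈ Ioo a b) :
    IsGeodesicFrom x ((s • w : E)) (fun t ↦ γ (s * t)) := by
  refine ⟨?_, ?_⟩
  -- At `ε = 0` the rescaled end points are `0` and `s`, both inside the open interval, so some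
  -- positive margin remains.
  · have hcont : ContinuousAt (fun ε : ℝ ↦ (s * (-ε), s * (1 + ε))) 0 := by fun_prop
    have hmem : Ioo a b ×ˢ Ioo a b ∈ 𝓝 (s * (-(0 : ℝ)), s * (1 + (0 : ℝ))) :=
      (isOpen_Ioo.prod isOpen_Ioo).mem_nhds ⟨by simpa using ⟨ha, hb⟩, by simpa using hs⟩
    obtain ⟨δ, hδ, hδ'⟩ := Metric.eventually_nhds_iff_ball.1 (hcont.eventually hmem)
    have hδ2 := hδ' (δ / 2) (by rw [Real.ball_eq_Ioo]; constructor <;> linarith)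
    refine ⟨δ / 2, half_pos hδ, fun t ht ↦ h.comp_mul s t ?_⟩
    have hseg : s * t ∈ Ioo a b := by
      rcases le_total 0 s with h0s | h0s
      · exact ⟨lt_of_lt_of_le hδ2.1.1 (mul_le_mul_of_nonneg_left ht.1.le h0s),
          lt_of_le_of_lt (mul_le_mul_of_nonneg_left ht.2.le h0s) hδ2.2.2⟩
      · exact ⟨lt_of_lt_of_le hδ2.2.1 (mul_le_mul_of_nonpos_left ht.2.le h0s),
          lt_of_le_of_lt (mul_le_mul_of_nonpos_left ht.1.le h0s) hδ2.1.2⟩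
    exact hseg
  · obtain ⟨ξ, hξ⟩ := h.hasMFDerivAt (t := 0) ⟨ha, hb⟩
    rw [velocityLift_eq hξ] at h0
    cases h0
    obtain ⟨h1, h2⟩ := hasMFDerivAt_curve_iff.1 hξ
    have hmd : HasDerivAt (fun t : ℝ ↦ s * t) s 0 := by
      simpa using (hasDerivAt_id (0 : ℝ)).const_mul s
    have h3 : HasDerivAt (fun t ↦ extChartAt 𝓘(ℝ, E) (γ (s * 0)) (γ (s * t))) (s • ξ : E) 0 := by
      rw [mul_zero]
      exact HasDerivAt.scomp (g₁ := fun t ↦ extChartAt 𝓘(ℝ, E) (γ 0) (γ t))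
        (h := fun t : ℝ ↦ s * t) 0 (by rwa [mul_zero]) hmd
    have h4 : ContinuousAt (fun t ↦ γ (s * t)) 0 :=
      ContinuousAt.comp (f := fun t : ℝ ↦ s * t) (by rwa [mul_zero]) hmd.continuousAt
    refine (velocityLift_eq (hasMFDerivAt_curve_iff.2 ⟨h4, h3⟩)).trans ?_
    exact tangentBundle_mk_congr (by rw [mul_zero]) _

variable [IsManifold 𝓘(ℝ, E) ∞ M] [FiniteDimensional ℝ E] [T2Space M]
  [IsContMDiffRiemannianBundle 𝓘(ℝ, E) ∞ E (fun x : M ↦ TangentSpace 𝓘(ℝ, E) x)]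

theorem IsGeodesicOn.velocityLift_eq_of_eq {γ γ' : ℝ → M} {a b a' b' s t : ℝ}
    (h : IsGeodesicOn (E := E) γ (Ioo a b)) (h' : IsGeodesicOn (E := E) γ' (Ioo a' b'))
    (hs : s ∈ Ioo a b) (hs' : s ∈ Ioo a' b') (ht : t ∈ Ioo a b) (ht' : t ∈ Ioo a' b')
    (heq : velocityLift (E := E) γ s = velocityLift γ' s) :
    velocityLift (E := E) γ t = velocityLift γ' t := by
  have : T2Space (TangentBundle 𝓘(ℝ, E) M) := t2Space_totalSpace _
  exact (h.isMIntegralCurveOn isOpen_Ioo).eq_of_eq (contMDiff_geodesicSpray.of_le (by simp))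
    (h'.isMIntegralCurveOn isOpen_Ioo) hs hs' ht ht' heq

/-- The definition picks some geodesic; by uniqueness any other has the same end point. -/
theorem expMap_eq {x : M} {v : TangentSpace 𝓘(ℝ, E) x} {γ : ℝ → M} (h : IsGeodesicFrom x v γ) :
    expMap x v = γ 1 := by
  have hex : ∃ γ, IsGeodesicFrom x v γ := ⟨γ, h⟩
  rw [expMap, dif_pos hex]
  obtain ⟨⟨ε, hε, h1⟩, h2⟩ := h
  obtain ⟨⟨ε', hε', h1'⟩, h2'⟩ := hex.choose_spec
  exact congrArg TotalSpace.proj (h1'.velocityLift_eq_of_eq h1 (s := 0) (t := 1)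
    ⟨by linarith, by linarith⟩ ⟨by linarith, by linarith⟩ ⟨by linarith, by linarith⟩
    ⟨by linarith, by linarith⟩ (h2'.trans h2.symm))

/-- A geodesic whose initial velocity is not zero has no zero velocity. -/
theorem IsGeodesicOn.fiberVec_ne_zero {γ : ℝ → M} {a b s t : ℝ}
    (h : IsGeodesicOn (E := E) γ (Ioo a b)) (hs : s ∈ Ioo a b) (ht : t ∈ Ioo a b)
    (h0 : fiberVec (velocityLift (E := E) γ s) ≠ 0) : fiberVec (velocityLift (E := E) γ t) ≠ 0 := by
  intro hz
  have : T2Space (TangentBundle 𝓘(ℝ, E) M) := t2Space_totalSpace _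
  let z : TangentBundle 𝓘(ℝ, E) M := ⟨γ t, (0 : E)⟩
  have hzt : velocityLift (E := E) γ t = z :=
    congrArg (fun v : E ↦ (⟨γ t, v⟩ : TangentBundle 𝓘(ℝ, E) M)) hz
  -- The acceleration is quadratic in the velocity, so a zero vector is a rest point; the lift would
  -- coincide with a constant curve at zero velocity.
  have hz0 : geodesicSpray z = 0 := by
    have : christoffelForm (γ t) (extChartAt 𝓘(ℝ, E) (γ t) (γ t)) 0 = 0 := by
      rw [christoffelForm, map_zero, map_zero, smul_zero, sub_zero]
    have h2 : geodesicAcc (γ t) (extChartAt 𝓘(ℝ, E) (γ t) (γ t)) 0 = 0 := by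
      rw [geodesicAcc, this, map_zero, neg_zero]
    exact Prod.ext rfl h2
  have hc : IsMIntegralCurveOn (I := 𝓘(ℝ, E).tangent) (fun _ ↦ z) geodesicSpray (Ioo a b) :=
    (isMIntegralCurve_const hz0).isMIntegralCurveOn _
  have := (h.isMIntegralCurveOn isOpen_Ioo).eq_of_eq
    (contMDiff_geodesicSpray.of_le (by simp)) hc ht ht hs hs hzt
  exact h0 (congrArg fiberVec this)

omit [T2Space M] in
/-- Geodesics exist for short times. -/
theorem exists_isGeodesicOn (x : M) (w : TangentSpace 𝓘(ℝ, E) x) :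
    ∃ ε > 0, ∃ γ : ℝ → M, IsGeodesicOn (E := E) γ (Ioo (-ε) ε) ∧ velocityLift γ 0 = ⟨x, w⟩ := by
  have : CompleteSpace E := FiniteDimensional.complete ℝ E
  obtain ⟨Z, hZ0, hZ⟩ := exists_isMIntegralCurveAt_of_contMDiffAt_boundaryless
    (I := 𝓘(ℝ, E).tangent) (v := geodesicSpray) (t₀ := 0) (x₀ := ⟨x, w⟩)
    ((contMDiff_geodesicSpray (E := E) (M := M)).contMDiffAt.of_le (by simp))
  obtain ⟨ε, hε, h⟩ := isMIntegralCurveAt_iff'.1 hZ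
  rw [Real.ball_eq_Ioo, zero_sub, zero_add] at h
  obtain ⟨h1, h2⟩ := isGeodesicOn_of_isMIntegralCurveOn isOpen_Ioo h
  exact ⟨ε, hε, _, h1, (h2 0 ⟨by linarith, hε⟩).trans hZ0⟩

/-- `Φ` is, near `z`, the time-1-map of the geodesic flow. -/
def IsGeodesicFlowAt (Φ : TangentBundle 𝓘(ℝ, E) M → TangentBundle 𝓘(ℝ, E) M)
    (z₀ : TangentBundle 𝓘(ℝ, E) M) : Prop :=
  ∀ᶠ z in 𝓝 z₀, (∃ γ : ℝ → M, IsGeodesicFrom z.proj z.2 γ) ∧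
    ∀ γ : ℝ → M, IsGeodesicFrom z.proj z.2 γ → velocityLift γ 1 = Φ z

/-- The time-1-map of the geodesic flow is differentiable. -/
theorem exists_isGeodesicFlowAt {x : M} {v : TangentSpace 𝓘(ℝ, E) x} (hv : v ∈ expDomain x) :
    ∃ Φ, IsGeodesicFlowAt Φ ⟨x, v⟩ ∧
      MDifferentiableAt 𝓘(ℝ, E).tangent 𝓘(ℝ, E).tangent Φ ⟨x, v⟩ := by
  have : T2Space (TangentBundle 𝓘(ℝ, E) M) := t2Space_totalSpace _
  have : CompleteSpace E := FiniteDimensional.complete ℝ E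
  obtain ⟨γ, ⟨ε, hε, h1⟩, h2⟩ := hv
  have h2 : velocityLift γ 0 = (⟨x, v⟩ : TangentBundle 𝓘(ℝ, E) M) := h2
  obtain ⟨Φ, hΦ⟩ := (h1.isMIntegralCurveOn isOpen_Ioo).exists_isFlowMapAt
    (contMDiff_geodesicSpray.of_le (WithTop.coe_le_coe.2 le_top)) (s := 0) (T := 1)
    (by linarith) zero_le_one (by linarith)
  rw [h2] at hΦ
  refine ⟨Φ, ?_, hΦ.1⟩
  filter_upwards [hΦ.2, hΦ.apply_eq (contMDiff_geodesicSpray.of_le (by simp)) zero_le_one]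
    with z ⟨δ, hδ, σ, hσ, hσ0, hσ1⟩ hz
  refine ⟨?_, ?_⟩
  · obtain ⟨g1, g2⟩ := isGeodesicOn_of_isMIntegralCurveOn isOpen_Ioo hσ
    refine ⟨fun t ↦ (σ t).proj, ⟨δ, hδ, by rwa [zero_sub] at g1⟩, ?_⟩
    exact (g2 0 ⟨by linarith, by linarith⟩).trans hσ0
  · rintro γ ⟨⟨δ, hδ, h3⟩, h4⟩
    exact hz (velocityLift γ) _ _ (h3.isMIntegralCurveOn isOpen_Ioo) (by linarith) (by linarith) h4

end Exp

end ConjugatePoints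

end

noncomputable section

namespace ConjugatePoints

open Filter

/-! ### The differential of the exponential map -/

section ExpKer

variable {E : Type*} [NormedAddCommGroup E] [NormedSpace ℝ E]
  {M : Type*} [TopologicalSpace M] [ChartedSpace E M] [IsManifold 𝓘(ℝ, E) ∞ M]

theorem extChartAt_tangentBundle_symm_mk (x : M) (v w : E) :
    (extChartAt 𝓘(ℝ, E).tangent (⟨x, v⟩ : TangentBundle 𝓘(ℝ, E) M)).symm
      (extChartAt 𝓘(ℝ, E) x x, w) = ⟨x, w⟩ := by
  have h : extChartAt 𝓘(ℝ, E).tangent (⟨x, v⟩ : TangentBundle 𝓘(ℝ, E) M) ⟨x, w⟩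
      = (extChartAt 𝓘(ℝ, E) x x, w) := by
    rw [extChartAt_tangentBundle]
    exact Prod.ext rfl (tangentCoordChange_self (mem_extChartAt_source x))
  rw [← h]
  exact (extChartAt 𝓘(ℝ, E).tangent _).left_inv
    ((mem_extChartAt_tangentBundle_source _ _).2 (mem_extChartAt_source x))

variable [RiemannianBundle (fun x : M ↦ TangentSpace 𝓘(ℝ, E) x)]

omit [IsManifold 𝓘(ℝ, E) ∞ M] in
theorem mem_expKer_iff {x : M} {v : TangentSpace 𝓘(ℝ, E) x} {A : E →L[ℝ] E}
    (hc : ContinuousAt (expMap x) v)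
    (h : HasFDerivAt (fun w : E ↦ extChartAt 𝓘(ℝ, E) (expMap x v)
      (expMap (E := E) x w)) A v) (w : E) :
    w ∈ expKer x v ↔ A w = 0 := by
  have h1 : HasMFDerivAt 𝓘(ℝ, TangentSpace 𝓘(ℝ, E) x) 𝓘(ℝ, E) (expMap x) v A :=
    ⟨hc, h.hasFDerivWithinAt (s := range id)⟩
  rw [expKer, h1.mfderiv]
  exact Iff.rfl

variable [FiniteDimensional ℝ E] [T2Space M]
  [IsContMDiffRiemannianBundle 𝓘(ℝ, E) ∞ E (fun x : M ↦ TangentSpace 𝓘(ℝ, E) x)]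

omit [FiniteDimensional ℝ E] [T2Space M]
  [IsContMDiffRiemannianBundle 𝓘(ℝ, E) ∞ E (fun x : M ↦ TangentSpace 𝓘(ℝ, E) x)]
  [RiemannianBundle (fun x : M ↦ TangentSpace 𝓘(ℝ, E) x)] in
theorem continuous_tangentBundle_mk (x : M) :
    Continuous (fun w : E ↦ (⟨x, w⟩ : TangentBundle 𝓘(ℝ, E) M)) :=
  FiberBundle.continuous_totalSpaceMk E (TangentSpace 𝓘(ℝ, E)) x

/-- The exponential map is differentiable, and its differential is a block of the differential of
the time-1-map of the geodesic flow. -/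
theorem IsGeodesicFlowAt.hasFDerivAt_expMap {x : M} {v : TangentSpace 𝓘(ℝ, E) x}
    {Φ : TangentBundle 𝓘(ℝ, E) M → TangentBundle 𝓘(ℝ, E) M} (hΦ : IsGeodesicFlowAt Φ ⟨x, v⟩)
    (hΦc : ContinuousAt Φ ⟨x, v⟩) {L : E × E →L[ℝ] E × E}
    (hL : HasFDerivAt (fun p : E × E ↦ extChartAt 𝓘(ℝ, E).tangent (Φ ⟨x, v⟩)
      (Φ ((extChartAt 𝓘(ℝ, E).tangent (⟨x, v⟩ : TangentBundle 𝓘(ℝ, E) M)).symm p))) L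
      (extChartAt 𝓘(ℝ, E) x x, v)) :
    ContinuousAt (expMap x) v ∧
    HasFDerivAt (fun w : E ↦ extChartAt 𝓘(ℝ, E) (expMap x v) (expMap (E := E) x w))
      (ContinuousLinearMap.fst ℝ E E ∘L L ∘L ContinuousLinearMap.inr ℝ E E) v := by
  have hmk : ContinuousAt (fun w : E ↦ (⟨x, w⟩ : TangentBundle 𝓘(ℝ, E) M)) v :=
    (continuous_tangentBundle_mk x).continuousAt
  have hev : ∀ᶠ w : E in 𝓝 v, expMap (E := E) x w = (Φ ⟨x, w⟩).proj := by
    filter_upwards [hmk.eventually hΦ] with w ⟨⟨γ, hγ⟩, h⟩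
    rw [← h γ hγ]
    exact expMap_eq hγ
  have hv : expMap x v = (Φ ⟨x, v⟩).proj := hev.self_of_nhds
  have hc : ContinuousAt (fun w : E ↦ (Φ ⟨x, w⟩).proj) v :=
    (FiberBundle.continuous_proj E (TangentSpace 𝓘(ℝ, E))).continuousAt.comp
      (ContinuousAt.comp (f := fun w : E ↦ (⟨x, w⟩ : TangentBundle 𝓘(ℝ, E) M)) hΦc hmk)
  refine ⟨hc.congr (hev.mono fun w hw ↦ hw.symm), ?_⟩
  have h1 : HasFDerivAt (fun w : E ↦ (extChartAt 𝓘(ℝ, E) x x, w))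
      (ContinuousLinearMap.inr ℝ E E) v := hasFDerivAt_prodMk_right _ _
  have h2 := hasFDerivAt_fst.comp (v : E) (HasFDerivAt.comp (f := fun w : E ↦
    (extChartAt 𝓘(ℝ, E) x x, w)) (v : E) hL h1)
  refine h2.congr_of_eventuallyEq ?_
  filter_upwards [hev] with w hw
  rw [hw, hv]
  exact congrArg (fun z ↦ (extChartAt 𝓘(ℝ, E).tangent (Φ ⟨x, v⟩) (Φ z)).1)
    (extChartAt_tangentBundle_symm_mk (E := E) x v w).symm

/-- Coordinates for the differential of the time-1-map of the geodesic flow. -/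
theorem exists_hasFDerivAt_geodesicFlow {x : M} {v : TangentSpace 𝓘(ℝ, E) x}
    (hv : v ∈ expDomain x) :
    ∃ Φ, IsGeodesicFlowAt Φ ⟨x, v⟩ ∧ ContinuousAt Φ ⟨x, v⟩ ∧ ∃ L : E × E →L[ℝ] E × E,
      HasFDerivAt (fun p : E × E ↦ extChartAt 𝓘(ℝ, E).tangent (Φ ⟨x, v⟩)
        (Φ ((extChartAt 𝓘(ℝ, E).tangent (⟨x, v⟩ : TangentBundle 𝓘(ℝ, E) M)).symm p))) L
        (extChartAt 𝓘(ℝ, E) x x, v) := by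
  obtain ⟨Φ, h1, h2⟩ := exists_isGeodesicFlowAt hv
  refine ⟨Φ, h1, h2.continuousAt, ?_⟩
  have h3 := ((mdifferentiableAt_iff _ _).1 h2).2
  have hr : range 𝓘(ℝ, E).tangent = univ := ModelWithCorners.Boundaryless.range_eq_univ
  rw [hr, differentiableWithinAt_univ] at h3
  have h4 : extChartAt 𝓘(ℝ, E).tangent (⟨x, v⟩ : TangentBundle 𝓘(ℝ, E) M) ⟨x, v⟩
      = (extChartAt 𝓘(ℝ, E) x x, v) :=
    Prod.ext rfl (tangentCoordChange_self (mem_extChartAt_source x))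
  rw [h4] at h3
  exact ⟨_, h3.hasFDerivAt⟩

/-- The differential of the exponential map is not zero. -/
theorem finrank_expKer_lt [Nontrivial E] {x : M} {v : TangentSpace 𝓘(ℝ, E) x}
    (hv : v ∈ expDomain x) : finrank ℝ (expKer x v) < finrank ℝ E := by
  obtain ⟨Φ, hΦ, hΦc, L, hL⟩ := exists_hasFDerivAt_geodesicFlow hv
  obtain ⟨hc, hA⟩ := hΦ.hasFDerivAt_expMap hΦc hL
  set A := ContinuousLinearMap.fst ℝ E E ∘L L ∘L ContinuousLinearMap.inr ℝ E E
  have hker := mem_expKer_iff hc hA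
  -- For `v ≠ 0` take `w = v` and `s = 1`. For `v = 0` any nonzero `w` with `s = 0` works.
  obtain ⟨γ, a, b, s, w, hγ, ha, hb, hs, hw0, hw, hsw⟩ : ∃ (γ : ℝ → M) (a b s : ℝ) (w : E),
      IsGeodesicOn (E := E) γ (Ioo a b) ∧ a < 0 ∧ 0 < b ∧ s ∈ Ioo a b ∧
      velocityLift γ 0 = (⟨x, w⟩ : TangentBundle 𝓘(ℝ, E) M) ∧ w ≠ 0 ∧ s • w = v := by
    by_cases h0 : (v : E) = 0
    · obtain ⟨w, hw⟩ := exists_ne (0 : E)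
      obtain ⟨ε, hε, γ, hγ, h1⟩ := exists_isGeodesicOn x w
      exact ⟨γ, -ε, ε, 0, w, hγ, by linarith, hε, ⟨by linarith, hε⟩, h1, hw,
        (zero_smul ℝ w).trans h0.symm⟩
    · obtain ⟨γ, ⟨ε, hε, h1⟩, h2⟩ := hv
      exact ⟨γ, -ε, 1 + ε, 1, v, h1, by linarith, by linarith, ⟨by linarith, by linarith⟩, h2, h0,
        one_smul ℝ (v : E)⟩
  have hev : ∀ᶠ r in 𝓝 s, expMap (E := E) x (r • w : E) = γ r := by
    filter_upwards [isOpen_Ioo.mem_nhds hs] with r hr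
    have := expMap_eq (isGeodesicFrom_comp_mul hγ ha hb hw0 hr)
    rwa [mul_one] at this
  -- By the chain rule along `r ↦ r • w`, `A w` is the velocity of `γ` at `s`.
  have hAw : A w ≠ 0 := by
    intro h0
    have hd : HasDerivAt (fun r : ℝ ↦ r • w) w s := by
      simpa using (hasDerivAt_id s).smul_const w
    have hvs : expMap x v = γ s := by
      rw [← hev.self_of_nhds]; exact congrArg (expMap (E := E) x) hsw.symm
    rw [hvs] at hA
    have hA' : HasFDerivAt (fun w : E ↦ extChartAt 𝓘(ℝ, E) (γ s) (expMap (E := E) x w)) A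
      (s • w) := by rw [hsw]; exact hA
    have h1 : HasDerivAt (fun r ↦ extChartAt 𝓘(ℝ, E) (γ s) (γ r)) (A w) s :=
      (hA'.comp_hasDerivAt s hd).congr_of_eventuallyEq (by
        filter_upwards [hev] with r hr
        rw [Function.comp_apply, hr])
    have h2 := velocityLift_eq (hasMFDerivAt_curve_iff.2 ⟨(hγ s hs).1, h1⟩)
    refine hγ.fiberVec_ne_zero (s := 0) ⟨ha, hb⟩ hs ?_ ?_
    · rw [hw0]; exact hw
    · rw [h2]; exact h0
  have hne : expKer x v ≠ ⊤ := by
    intro h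
    exact hAw ((hker w).1 ((Submodule.eq_top_iff'.1 h) w))
  have : FiniteDimensional ℝ (TangentSpace 𝓘(ℝ, E) x) := inferInstanceAs (FiniteDimensional ℝ E)
  exact Submodule.finrank_lt hne

omit [FiniteDimensional ℝ E] [T2Space M] [IsManifold 𝓘(ℝ, E) ∞ M]
  [IsContMDiffRiemannianBundle 𝓘(ℝ, E) ∞ E (fun x : M ↦ TangentSpace 𝓘(ℝ, E) x)] in
theorem IsConjugateAlong.nontrivial {x : M} {v : TangentSpace 𝓘(ℝ, E) x}
    (h : IsConjugateAlong x v) : Nontrivial E := by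
  obtain ⟨w, -, hw⟩ := Submodule.exists_mem_ne_zero_of_ne_bot h.2
  exact ⟨⟨w, 0, hw⟩⟩

end ExpKer

end ConjugatePoints

end

noncomputable section

namespace ConjugatePoints

open Filter

/-! ### Canonical coordinates of the cotangent bundle -/

section Cotangent

variable {E : Type*} [NormedAddCommGroup E] [NormedSpace ℝ E]
  {M : Type*} [TopologicalSpace M] [ChartedSpace E M] [IsManifold 𝓘(ℝ, E) ∞ M]

/-- The covector of an element of the cotangent bundle, in the chart at its base point. -/
def covec (α : CotangentBundle E M) : E →L[ℝ] ℝ := α.2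

theorem canonicalCoords_eq {c : M} {α : CotangentBundle E M}
    (h : α.proj ∈ (extChartAt 𝓘(ℝ, E) c).source) :
    canonicalCoords c α = (extChartAt 𝓘(ℝ, E) c α.proj,
      covec α ∘L tangentCoordChange 𝓘(ℝ, E) c α.proj α.proj) := by
  have h1 := chartSymmDeriv_eq ((extChartAt 𝓘(ℝ, E) c).map_source h)
  rw [(extChartAt 𝓘(ℝ, E) c).left_inv h] at h1
  exact Prod.ext rfl (congrArg (fun D : E →L[ℝ] E ↦ covec α ∘L D) h1)

theorem mem_extChartAt_cotangentBundle_source (α₀ α : CotangentBundle E M) :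
    α ∈ (extChartAt (cotangentModel E) α₀).source ↔
      α.proj ∈ (extChartAt 𝓘(ℝ, E) α₀.proj).source := by
  rw [extChartAt_source, extChartAt_source, FiberBundle.chartedSpace_chartAt]
  simp only [mfld_simps]
  exact ⟨fun h ↦ h.1.1, fun h ↦ ⟨⟨h, mem_univ _⟩, h⟩⟩

/-- The trivialization of the cotangent bundle precomposes a covector with the inverse
trivialization of the tangent bundle, which is the derivative of the inverse chart. Thus the bundle
charts are Darboux charts. -/
theorem extChartAt_cotangentBundle {α₀ α : CotangentBundle E M}
    (h : α.proj ∈ (extChartAt 𝓘(ℝ, E) α₀.proj).source) :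
    extChartAt (cotangentModel E) α₀ α = canonicalCoords α₀.proj α := by
  rw [canonicalCoords_eq h]
  rw [extChartAt_source] at h
  refine Prod.ext rfl ?_
  have h1 : (extChartAt (cotangentModel E) α₀ α).2 =
      ContinuousLinearMap.inCoordinates E (TangentSpace 𝓘(ℝ, E)) ℝ (Trivial M ℝ)
        α₀.proj α.proj α₀.proj α.proj α.2 := rfl
  rw [h1, ContinuousLinearMap.inCoordinates, TangentBundle.symmL_trivializationAt_eq_core h]
  ext v
  simp
  rfl

theorem eventually_extChartAt_cotangentBundle (α : CotangentBundle E M) :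
    ∀ᶠ β in 𝓝 α, β.proj ∈ (extChartAt 𝓘(ℝ, E) α.proj).source ∧
      extChartAt (cotangentModel E) α β = canonicalCoords α.proj β := by
  filter_upwards [(isOpen_extChartAt_source (I := cotangentModel E) α).mem_nhds
    (mem_extChartAt_source α)] with β hβ
  rw [mem_extChartAt_cotangentBundle_source] at hβ
  exact ⟨hβ, extChartAt_cotangentBundle hβ⟩

/-- The canonical symplectic form, in the canonical coordinates given by the chart at the base
point. -/
theorem cotangentSymplectic_eq (α : CotangentBundle E M) (ξ η : E × (E →L[ℝ] ℝ)) :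
    cotangentSymplectic α ξ η = stdSymplectic ξ η := by
  have h1 : mfderiv (cotangentModel E) 𝓘(ℝ, E × (E →L[ℝ] ℝ)) (canonicalCoords α.proj) α
      = ContinuousLinearMap.id ℝ _ := by
    rw [← mfderiv_extChartAt_self]
    exact Filter.EventuallyEq.mfderiv_eq
      ((eventually_extChartAt_cotangentBundle α).mono fun β hβ ↦ hβ.2.symm)
  exact congrArg (fun D : E × (E →L[ℝ] ℝ) →L[ℝ] E × (E →L[ℝ] ℝ) ↦ stdSymplectic (D ξ) (D η)) h1

end Cotangent

/-! ### The geodesic Hamiltonian in canonical coordinates -/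

section Hamiltonian

variable {E : Type*} [NormedAddCommGroup E] [NormedSpace ℝ E] [FiniteDimensional ℝ E]
  {M : Type*} [TopologicalSpace M] [ChartedSpace E M] [IsManifold 𝓘(ℝ, E) ∞ M]
  [RiemannianBundle (fun x : M ↦ TangentSpace 𝓘(ℝ, E) x)]

local instance : NormedAddCommGroup (E →L[ℝ] E →L[ℝ] ℝ) :=
  ContinuousLinearMap.toNormedAddCommGroup

local instance : NormedSpace ℝ (E →L[ℝ] E →L[ℝ] ℝ) := ContinuousLinearMap.toNormedSpace

/-- The vector that the metric associates with a covector. -/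
def sharpVec (α : CotangentBundle E M) : E :=
  letI y : TangentSpace 𝓘(ℝ, E) α.proj →L[ℝ] ℝ := α.2
  haveI : FiniteDimensional ℝ (TangentSpace 𝓘(ℝ, E) α.proj) :=
    inferInstanceAs (FiniteDimensional ℝ E)
  haveI : CompleteSpace (TangentSpace 𝓘(ℝ, E) α.proj) := FiniteDimensional.complete ℝ _
  (InnerProductSpace.toDual ℝ (TangentSpace 𝓘(ℝ, E) α.proj)).symm y

omit [IsManifold 𝓘(ℝ, E) ∞ M] in
theorem innerAt_sharpVec (α : CotangentBundle E M) (v : E) :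
    innerAt α.proj (sharpVec α) v = covec α v :=
  haveI : FiniteDimensional ℝ (TangentSpace 𝓘(ℝ, E) α.proj) :=
    inferInstanceAs (FiniteDimensional ℝ E)
  haveI : CompleteSpace (TangentSpace 𝓘(ℝ, E) α.proj) := FiniteDimensional.complete ℝ _
  InnerProductSpace.toDual_symm_apply (𝕜 := ℝ) (E := TangentSpace 𝓘(ℝ, E) α.proj)

omit [IsManifold 𝓘(ℝ, E) ∞ M] in
theorem geodesicHamiltonian_eq (α : CotangentBundle E M) :
    geodesicHamiltonian α = covec α (sharpVec α) / 2 := rfl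

theorem chartSharp_canonicalCoords {c : M} {α : CotangentBundle E M}
    (h : α.proj ∈ (extChartAt 𝓘(ℝ, E) c).source) :
    chartSharp c (canonicalCoords c α).1 (canonicalCoords c α).2
      = tangentCoordChange 𝓘(ℝ, E) α.proj c α.proj (sharpVec α) := by
  have hs := mem_extChartAt_source (I := 𝓘(ℝ, E)) α.proj
  have hu := (extChartAt 𝓘(ℝ, E) c).map_source h
  rw [canonicalCoords_eq h]
  have : covec α ∘L tangentCoordChange 𝓘(ℝ, E) c α.proj α.proj
      = chartMetricL c (extChartAt 𝓘(ℝ, E) c α.proj)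
        (tangentCoordChange 𝓘(ℝ, E) α.proj c α.proj (sharpVec α)) := by
    ext z
    rw [chartMetricL_apply, chartMetric_eq_innerAt hu, (extChartAt 𝓘(ℝ, E) c).left_inv h,
      tangentCoordChange_comp ⟨⟨hs, h⟩, hs⟩, tangentCoordChange_self hs, innerAt_sharpVec,
      ContinuousLinearMap.comp_apply]
  rw [this, chartSharp_chartMetricL hu]

theorem geodesicHamiltonian_eq_chart {c : M} {α : CotangentBundle E M}
    (h : α.proj ∈ (extChartAt 𝓘(ℝ, E) c).source) :
    geodesicHamiltonian α = (canonicalCoords c α).2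
      (chartSharp c (canonicalCoords c α).1 (canonicalCoords c α).2) / 2 := by
  have hs := mem_extChartAt_source (I := 𝓘(ℝ, E)) α.proj
  rw [chartSharp_canonicalCoords h, canonicalCoords_eq h, ContinuousLinearMap.comp_apply,
    tangentCoordChange_comp ⟨⟨hs, h⟩, hs⟩, tangentCoordChange_self hs, geodesicHamiltonian_eq]

variable [IsContMDiffRiemannianBundle 𝓘(ℝ, E) ∞ E (fun x : M ↦ TangentSpace 𝓘(ℝ, E) x)]

/-- The relation for `S` comes from differentiating the identity `chartMetricL (chartSharp y) = y`;
it avoids a formula for the derivative of the inverse metric. -/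
theorem exists_hasFDerivAt_chartSharp {c : M} {p : E × (E →L[ℝ] ℝ)}
    (hu : p.1 ∈ (extChartAt 𝓘(ℝ, E) c).target) :
    ∃ S : E × (E →L[ℝ] ℝ) →L[ℝ] E, HasFDerivAt (fun p ↦ chartSharp c p.1 p.2) S p ∧
      ∀ η, fderiv ℝ (chartMetricL c) p.1 η.1 (chartSharp c p.1 p.2) + chartMetricL c p.1 (S η)
        = η.2 := by
  have h1 : HasFDerivAt (fun p : E × (E →L[ℝ] ℝ) ↦ chartSharp c p.1) _ p :=
    HasFDerivAt.comp (g := chartSharp c) (f := Prod.fst) p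
    ((contDiffAt_chartSharp hu).differentiableAt (by simp)).hasFDerivAt hasFDerivAt_fst
  have h2 := h1.clm_apply hasFDerivAt_snd
  refine ⟨_, h2, fun η ↦ ?_⟩
  have h3 : HasFDerivAt (fun p : E × (E →L[ℝ] ℝ) ↦ chartMetricL c p.1) _ p :=
    HasFDerivAt.comp (g := chartMetricL c) (f := Prod.fst) p
    (hasFDerivAt_chartMetricL hu) hasFDerivAt_fst
  have h4 := h3.clm_apply h2
  have h5 : HasFDerivAt (fun p : E × (E →L[ℝ] ℝ) ↦ chartMetricL c p.1 (chartSharp c p.1 p.2))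
      (ContinuousLinearMap.snd ℝ E (E →L[ℝ] ℝ)) p := by
    refine hasFDerivAt_snd.congr_of_eventuallyEq ?_
    filter_upwards [continuousAt_fst.eventually ((isOpen_extChartAt_target c).mem_nhds hu)]
      with p hp
    exact chartMetricL_chartSharp hp p.2
  have h6 := congrArg (fun L : E × (E →L[ℝ] ℝ) →L[ℝ] (E →L[ℝ] ℝ) ↦ L η) (h4.unique h5)
  rw [add_comm]
  exact h6

/-- The differential of the Hamiltonian in canonical coordinates. -/
theorem exists_hasFDerivAt_chartHamiltonian {c : M} {p : E × (E →L[ℝ] ℝ)}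
    (hu : p.1 ∈ (extChartAt 𝓘(ℝ, E) c).target) :
    ∃ A : E × (E →L[ℝ] ℝ) →L[ℝ] ℝ, HasFDerivAt (fun p ↦ p.2 (chartSharp c p.1 p.2) / 2) A p ∧
      ∀ η, A η = η.2 (chartSharp c p.1 p.2)
        - fderiv ℝ (chartMetricL c) p.1 η.1 (chartSharp c p.1 p.2) (chartSharp c p.1 p.2) / 2 := by
  obtain ⟨S, hS, hS'⟩ := exists_hasFDerivAt_chartSharp hu
  have h1 := (hasFDerivAt_snd.clm_apply hS).const_mul (2⁻¹ : ℝ)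
  have h2 : HasFDerivAt (fun p : E × (E →L[ℝ] ℝ) ↦ p.2 (chartSharp c p.1 p.2) / 2) _ p :=
    h1.congr_of_eventuallyEq (Eventually.of_forall fun p ↦ by ring)
  refine ⟨_, h2, fun η ↦ ?_⟩
  have h3 := congrArg (fun y : E →L[ℝ] ℝ ↦ y (chartSharp c p.1 p.2)) (hS' η)
  -- Symmetry of the metric lets the relation for `S`, evaluated at the raised covector, compute
  -- this term.
  have h4 : p.2 (S η) = chartMetricL c p.1 (S η) (chartSharp c p.1 p.2) := by
    conv_lhs => rw [← chartMetricL_chartSharp hu p.2]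
    exact chartMetric_comm _ _ _ _
  simp only [add_apply] at h3
  simp only [smul_apply, add_apply, ContinuousLinearMap.comp_apply, ContinuousLinearMap.flip_apply,
    ContinuousLinearMap.coe_snd', smul_eq_mul, h4]
  linarith

theorem mfderiv_geodesicHamiltonian (α : CotangentBundle E M) (η : E × (E →L[ℝ] ℝ)) :
    mfderiv (cotangentModel E) 𝓘(ℝ, ℝ) geodesicHamiltonian α η = η.2 (sharpVec α)
      - fderiv ℝ (chartMetricL α.proj) (extChartAt 𝓘(ℝ, E) α.proj α.proj) η.1 (sharpVec α)
        (sharpVec α) / 2 := by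
  have hs := mem_extChartAt_source (I := 𝓘(ℝ, E)) α.proj
  obtain ⟨A, hA, hA'⟩ := exists_hasFDerivAt_chartHamiltonian (c := α.proj)
    (p := canonicalCoords α.proj α) ((extChartAt 𝓘(ℝ, E) α.proj).map_source hs)
  rw [chartSharp_canonicalCoords hs, tangentCoordChange_self hs] at hA'
  refine Eq.trans ?_ (hA' η)
  have h1 : HasMFDerivAt (cotangentModel E) 𝓘(ℝ, E × (E →L[ℝ] ℝ))
      (extChartAt (cotangentModel E) α) α (ContinuousLinearMap.id ℝ _) := by
    rw [← mfderiv_extChartAt_self]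
    exact (mdifferentiableAt_extChartAt (mem_chart_source _ α)).hasMFDerivAt
  have h2 := hA.hasMFDerivAt
  rw [← extChartAt_cotangentBundle hs] at h2
  have h3 := h2.comp α h1
  have h4 : HasMFDerivAt (cotangentModel E) 𝓘(ℝ, ℝ) geodesicHamiltonian α A := by
    refine h3.congr_of_eventuallyEq ?_
    filter_upwards [eventually_extChartAt_cotangentBundle α] with β ⟨hβ, hβ'⟩
    rw [Function.comp_apply, hβ', geodesicHamiltonian_eq_chart hβ]
  rw [h4.mfderiv]
  rfl

end Hamiltonian

end ConjugatePoints

end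

noncomputable section

namespace ConjugatePoints

open Filter

/-! ### Hamiltonian motions are geodesics -/

section Motion

variable {E : Type*} [NormedAddCommGroup E] [NormedSpace ℝ E] [FiniteDimensional ℝ E]
  {M : Type*} [TopologicalSpace M] [ChartedSpace E M] [IsManifold 𝓘(ℝ, E) ∞ M]
  [RiemannianBundle (fun x : M ↦ TangentSpace 𝓘(ℝ, E) x)]
  [IsContMDiffRiemannianBundle 𝓘(ℝ, E) ∞ E (fun x : M ↦ TangentSpace 𝓘(ℝ, E) x)]

local instance : NormedAddCommGroup (E →L[ℝ] E →L[ℝ] ℝ) :=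
  ContinuousLinearMap.toNormedAddCommGroup

local instance : NormedSpace ℝ (E →L[ℝ] E →L[ℝ] ℝ) := ContinuousLinearMap.toNormedSpace

/-- Hamilton's equations in canonical coordinates. -/
theorem IsHamiltonianMotionOn.hasDerivAt {a : ℝ → CotangentBundle E M} {J : Set ℝ}
    (h : IsHamiltonianMotionOn a J) {t : ℝ} (ht : t ∈ J) :
    ContinuousAt a t ∧ ∃ y' : E →L[ℝ] ℝ,
      HasDerivAt (fun s ↦ extChartAt (cotangentModel E) (a t) (a s)) (sharpVec (a t), y') t ∧
      ∀ z, y' z = fderiv ℝ (chartMetricL (a t).proj)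
        (extChartAt 𝓘(ℝ, E) (a t).proj (a t).proj) z (sharpVec (a t)) (sharpVec (a t)) / 2 := by
  obtain ⟨ξ, hξ, hω⟩ := h t ht
  obtain ⟨h1, h2⟩ := hasMFDerivAt_curve_iff.1 hξ
  obtain ⟨v, y'⟩ : E × (E →L[ℝ] ℝ) := ξ
  have hω' (η : E × (E →L[ℝ] ℝ)) : η.2 v - y' η.1 = η.2 (sharpVec (a t))
      - fderiv ℝ (chartMetricL (a t).proj) (extChartAt 𝓘(ℝ, E) (a t).proj (a t).proj) η.1
        (sharpVec (a t)) (sharpVec (a t)) / 2 :=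
    (cotangentSymplectic_eq (a t) (v, y') η).symm.trans
      ((hω η).trans (mfderiv_geodesicHamiltonian (a t) η))
  have hu := (extChartAt 𝓘(ℝ, E) (a t).proj).map_source (mem_extChartAt_source (a t).proj)
  have hv : v = sharpVec (a t) := by
    -- Testing with the covector dual to `v - sharpVec (a t)` shows that this difference has norm
    -- zero.
    have h3 := hω' (0, chartMetricL (a t).proj (extChartAt 𝓘(ℝ, E) (a t).proj (a t).proj)
      (v - sharpVec (a t)))
    simp only [map_zero, zero_apply, zero_div, sub_zero] at h3
    refine sub_eq_zero.1 (chartMetric_self_eq_zero hu ?_)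
    rw [← chartMetricL_apply, map_sub (chartMetricL _ _ _), h3, sub_self]
  subst hv
  refine ⟨h1, y', h2, fun z ↦ ?_⟩
  have h3 := hω' (z, 0)
  simp only [zero_apply] at h3
  linarith

theorem IsHamiltonianMotionOn.hasMFDerivAt_proj {a : ℝ → CotangentBundle E M} {J : Set ℝ}
    (h : IsHamiltonianMotionOn a J) {t : ℝ} (ht : t ∈ J) :
    HasMFDerivAt 𝓘(ℝ, ℝ) 𝓘(ℝ, E) (fun s ↦ (a s).proj) t
      ((1 : ℝ →L[ℝ] ℝ).smulRight (sharpVec (E := E) (a t) : TangentSpace 𝓘(ℝ, E) (a t).proj)) := by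
  obtain ⟨h1, y', h2, -⟩ := h.hasDerivAt ht
  refine hasMFDerivAt_curve_iff.2 ⟨?_, h2.fst⟩
  exact ContinuousAt.comp (f := a) (FiberBundle.continuous_proj (E →L[ℝ] ℝ) _).continuousAt h1

theorem IsHamiltonianMotionOn.velocityLift_eq {a : ℝ → CotangentBundle E M} {J : Set ℝ}
    (h : IsHamiltonianMotionOn a J) {t : ℝ} (ht : t ∈ J) :
    velocityLift (fun s ↦ (a s).proj) t
      = (⟨(a t).proj, sharpVec (E := E) (a t)⟩ : TangentBundle 𝓘(ℝ, E) M) :=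
  ConjugatePoints.velocityLift_eq (h.hasMFDerivAt_proj ht)

/-- Differentiating `q' = chartSharp (q, y)` gives `g(q'', ·) = y' - (D_{q'} g)(q', ·)`. With `y' z
= (D_z g)(q', q') / 2` this is the geodesic equation. -/
theorem IsHamiltonianMotionOn.isGeodesicOn {a : ℝ → CotangentBundle E M} {J : Set ℝ}
    (h : IsHamiltonianMotionOn a J) (hJ : IsOpen J) :
    IsGeodesicOn (E := E) (fun t ↦ (a t).proj) J := by
  intro t ht
  obtain ⟨h1, y', h2, hy'⟩ := h.hasDerivAt ht
  set c := (a t).proj with hc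
  set P : ℝ → E × (E →L[ℝ] ℝ) := fun s ↦ extChartAt (cotangentModel E) (a t) (a s) with hP
  have hs := mem_extChartAt_source (I := 𝓘(ℝ, E)) c
  have hu : (P t).1 ∈ (extChartAt 𝓘(ℝ, E) c).target := (extChartAt 𝓘(ℝ, E) c).map_source hs
  have hw : chartSharp c (P t).1 (P t).2 = sharpVec (a t) := by
    have := chartSharp_canonicalCoords hs
    rw [tangentCoordChange_self hs, ← extChartAt_cotangentBundle hs] at this
    exact this
  have hev : ∀ᶠ s in 𝓝 t, HasDerivAt (fun r ↦ extChartAt 𝓘(ℝ, E) c (a r).proj)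
      (chartSharp c (P s).1 (P s).2) s := by
    filter_upwards [hJ.mem_nhds ht, h1.eventually (eventually_extChartAt_cotangentBundle (a t))]
      with s hsJ ⟨hsc, hsP⟩
    have h3 := hasDerivAt_extChartAt_comp hsc (h.hasMFDerivAt_proj hsJ)
    have h4 : P s = canonicalCoords c (a s) := hsP
    rw [h4, chartSharp_canonicalCoords hsc]
    exact h3
  obtain ⟨S, hS, hS'⟩ := exists_hasFDerivAt_chartSharp hu
  have hdd : HasDerivAt (deriv fun r ↦ extChartAt 𝓘(ℝ, E) c (a r).proj)
      (S (sharpVec (a t), y')) t :=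
    HasDerivAt.congr_of_eventuallyEq (hS.comp_hasDerivAt t h2) (hev.mono fun s hs ↦ hs.deriv)
  refine ⟨(h.hasMFDerivAt_proj ht).continuousAt, hev.mono fun s hs ↦ hs.differentiableAt,
    hdd.differentiableAt, fun z ↦ ?_⟩
  have hd := hev.self_of_nhds.deriv
  rw [hw] at hd
  have hS2 := congrArg (fun y : E →L[ℝ] ℝ ↦ y z) (hS' (sharpVec (a t), y'))
  simp only [add_apply, hw, hy', chartMetricL_apply] at hS2
  have hu2 : (P t).1 = extChartAt 𝓘(ℝ, E) c c := rfl
  rw [hu2] at hS2 hu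
  change chartMetric c (extChartAt 𝓘(ℝ, E) c c)
    (deriv (deriv fun r ↦ extChartAt 𝓘(ℝ, E) c (a r).proj) t) z
    + christoffel c (extChartAt 𝓘(ℝ, E) c c) (deriv (fun r ↦ extChartAt 𝓘(ℝ, E) c (a r).proj) t)
      (deriv (fun r ↦ extChartAt 𝓘(ℝ, E) c (a r).proj) t) z = 0
  rw [hdd.deriv, hd]
  simp only [christoffel, fderiv_chartMetric hu]
  linarith

end Motion

end ConjugatePoints

end

noncomputable section

namespace ConjugatePoints

open Filter

/-! ### Degeneracy and the kernel of the differential of the exponential map -/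

section Degeneracy

variable {E : Type*} [NormedAddCommGroup E] [NormedSpace ℝ E] [FiniteDimensional ℝ E]
  {M : Type*} [TopologicalSpace M] [ChartedSpace E M] [IsManifold 𝓘(ℝ, E) ∞ M]
  [RiemannianBundle (fun x : M ↦ TangentSpace 𝓘(ℝ, E) x)]

local instance : NormedAddCommGroup (E →L[ℝ] E →L[ℝ] ℝ) :=
  ContinuousLinearMap.toNormedAddCommGroup

local instance : NormedSpace ℝ (E →L[ℝ] E →L[ℝ] ℝ) := ContinuousLinearMap.toNormedSpace

/-- The isomorphism of the cotangent bundle with the tangent bundle given by the metric. -/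
def sharpLift (α : CotangentBundle E M) : TangentBundle 𝓘(ℝ, E) M := ⟨α.proj, sharpVec (E := E) α⟩

theorem extChartAt_sharpLift {α₀ α : CotangentBundle E M}
    (h : α.proj ∈ (extChartAt 𝓘(ℝ, E) α₀.proj).source) :
    extChartAt 𝓘(ℝ, E).tangent (sharpLift α₀) (sharpLift α)
      = ((extChartAt (cotangentModel E) α₀ α).1, chartSharp α₀.proj
        (extChartAt (cotangentModel E) α₀ α).1 (extChartAt (cotangentModel E) α₀ α).2) := by
  rw [extChartAt_cotangentBundle h, chartSharp_canonicalCoords h]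
  rfl

variable [IsContMDiffRiemannianBundle 𝓘(ℝ, E) ∞ E (fun x : M ↦ TangentSpace 𝓘(ℝ, E) x)]

theorem exists_isGeodesicFrom_of_mem_flowGraph {g : CotangentBundle E M × CotangentBundle E M}
    (hg : g ∈ flowGraph E M) :
    ∃ γ, IsGeodesicFrom (E := E) g.1.proj (sharpVec (E := E) g.1) γ ∧
      velocityLift γ 1 = sharpLift g.2 := by
  obtain ⟨ε, hε, a, ha, h0, h1⟩ := hg
  refine ⟨fun t ↦ (a t).proj, ⟨⟨ε, hε, ha.isGeodesicOn isOpen_Ioo⟩, ?_⟩, ?_⟩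
  · rw [← h0]
    exact ha.velocityLift_eq ⟨by linarith, by linarith⟩
  · rw [← h1]
    exact ha.velocityLift_eq ⟨by linarith, by linarith⟩

/-- Variations of a solution of the boundary value problem through motions give, as long as they
fix the boundary conditions to first order, elements of the kernel of the differential of the
exponential map. -/
theorem finrank_le_finrank_expKer [T2Space M] {W : Type*} [NormedAddCommGroup W] [NormedSpace ℝ W]
    {σ : W → CotangentBundle E M × CotangentBundle E M} {w₀ : W} (hσc : ContinuousAt σ w₀)
    (hσ : ∀ᶠ w in 𝓝 w₀, σ w ∈ flowGraph E M)
    {B : W →L[ℝ] (E × (E →L[ℝ] ℝ)) × (E × (E →L[ℝ] ℝ))}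
    (hB : HasFDerivAt (fun w ↦ (extChartAt (cotangentModel E) (σ w₀).1 (σ w).1,
      extChartAt (cotangentModel E) (σ w₀).2 (σ w).2)) B w₀)
    {K : Submodule ℝ W} (hK : ∀ u ∈ K, (B u).1.1 = 0 ∧ (B u).2.1 = 0)
    (hinj : ∀ u ∈ K, B u = 0 → u = 0) :
    sharpVec (E := E) (σ w₀).1 ∈ expDomain (σ w₀).1.proj ∧
    finrank ℝ K ≤ finrank ℝ (expKer (E := E) (σ w₀).1.proj (sharpVec (E := E) (σ w₀).1)) := by
  obtain ⟨γ, hγ, hγ1⟩ := exists_isGeodesicFrom_of_mem_flowGraph hσ.self_of_nhds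
  have hdom : sharpVec (E := E) (σ w₀).1 ∈ expDomain (E := E) (σ w₀).1.proj := ⟨γ, hγ⟩
  refine ⟨hdom, ?_⟩
  obtain ⟨Φ, hΦ, hΦc, L, hL⟩ := exists_hasFDerivAt_geodesicFlow hdom
  obtain ⟨hc, hA⟩ := hΦ.hasFDerivAt_expMap hΦc hL
  have hker := mem_expKer_iff hc hA
  have hΦ0 : Φ (sharpLift (σ w₀).1) = sharpLift (σ w₀).2 := by
    rw [← hγ1]
    exact (hΦ.self_of_nhds.2 γ hγ).symm
  set α := (σ w₀).1
  set β := (σ w₀).2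
  have hsα := mem_extChartAt_source (I := 𝓘(ℝ, E)) α.proj
  have hsβ := mem_extChartAt_source (I := 𝓘(ℝ, E)) β.proj
  obtain ⟨S, hS, hS'⟩ := exists_hasFDerivAt_chartSharp (c := α.proj)
    (p := extChartAt (cotangentModel E) α α) ((extChartAt 𝓘(ℝ, E) α.proj).map_source hsα)
  obtain ⟨R, hR, hR'⟩ := exists_hasFDerivAt_chartSharp (c := β.proj)
    (p := extChartAt (cotangentModel E) β β) ((extChartAt 𝓘(ℝ, E) β.proj).map_source hsβ)
  -- the two sides of the equation that says that `Φ` maps the first end to the second one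
  have hB1 : HasFDerivAt (fun w ↦ extChartAt (cotangentModel E) α (σ w).1)
      (ContinuousLinearMap.fst ℝ _ _ ∘L B) w₀ := hB.fst
  have hB2 : HasFDerivAt (fun w ↦ extChartAt (cotangentModel E) β (σ w).2)
      (ContinuousLinearMap.snd ℝ _ _ ∘L B) w₀ := hB.snd
  have hS1 := hB1.fst.prodMk (HasFDerivAt.comp (f := fun w ↦ extChartAt (cotangentModel E) α
    (σ w).1) w₀ hS hB1)
  have hR1 := hB2.fst.prodMk (HasFDerivAt.comp (f := fun w ↦ extChartAt (cotangentModel E) β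
    (σ w).2) w₀ hR hB2)
  have hev : ∀ᶠ w in 𝓝 w₀, (σ w).1.proj ∈ (extChartAt 𝓘(ℝ, E) α.proj).source := by
    filter_upwards [(continuousAt_fst.comp hσc).eventually
      (eventually_extChartAt_cotangentBundle α)] with w hw using hw.1
  have hev' : ∀ᶠ w in 𝓝 w₀, (σ w).2.proj ∈ (extChartAt 𝓘(ℝ, E) β.proj).source := by
    filter_upwards [(continuousAt_snd.comp hσc).eventually
      (eventually_extChartAt_cotangentBundle β)] with w hw using hw.1
  set pt : W → E × E := fun w ↦ ((extChartAt (cotangentModel E) α (σ w).1).1,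
    chartSharp α.proj (extChartAt (cotangentModel E) α (σ w).1).1
      (extChartAt (cotangentModel E) α (σ w).1).2)
  have hpt0 : pt w₀ = (extChartAt 𝓘(ℝ, E) α.proj α.proj, sharpVec α) := by
    refine (extChartAt_sharpLift hsα).symm.trans ?_
    exact Prod.ext rfl (tangentCoordChange_self hsα)
  have hsymm : ∀ᶠ w in 𝓝 w₀,
      (extChartAt 𝓘(ℝ, E).tangent (sharpLift α)).symm (pt w) = sharpLift (σ w).1 := by
    filter_upwards [hev] with w hw
    have h1 : pt w = extChartAt 𝓘(ℝ, E).tangent (sharpLift α) (sharpLift (σ w).1) :=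
      (extChartAt_sharpLift hw).symm
    rw [h1]
    exact (extChartAt 𝓘(ℝ, E).tangent _).left_inv ((mem_extChartAt_tangentBundle_source _ _).2 hw)
  have hlift : ContinuousAt (fun w ↦ sharpLift (σ w).1) w₀ := by
    refine ContinuousAt.congr ?_ hsymm
    have h1 : ContinuousAt (extChartAt 𝓘(ℝ, E).tangent (sharpLift α)).symm (pt w₀) := by
      have h2 : pt w₀ = extChartAt 𝓘(ℝ, E).tangent (sharpLift α) (sharpLift α) :=
        (extChartAt_sharpLift hsα).symm
      rw [h2]
      exact continuousAt_extChartAt_symm (sharpLift α)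
    exact ContinuousAt.comp (f := pt) h1 hS1.continuousAt
  have hflow : ∀ᶠ w in 𝓝 w₀, Φ (sharpLift (σ w).1) = sharpLift (σ w).2 := by
    filter_upwards [hlift.eventually hΦ, hσ] with w hw hwσ
    obtain ⟨γ, hγ, hγ1⟩ := exists_isGeodesicFrom_of_mem_flowGraph hwσ
    rw [← hγ1]
    exact (hw.2 γ hγ).symm
  have hL' : HasFDerivAt (fun p : E × E ↦ extChartAt 𝓘(ℝ, E).tangent (sharpLift β)
      (Φ ((extChartAt 𝓘(ℝ, E).tangent (sharpLift α)).symm p))) L (pt w₀) := by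
    rw [hpt0, ← hΦ0]
    exact hL
  have hcomp := HasFDerivAt.comp (f := pt) w₀ hL' hS1
  have heq := hcomp.unique (hR1.congr_of_eventuallyEq (by
    filter_upwards [hflow, hsymm, hev'] with w hw hw' hw2
    rw [Function.comp_apply, hw', hw, extChartAt_sharpLift hw2]
    rfl))
  -- On `K` the base components vanish, so the derivative `L` of the geodesic flow carries the
  -- raised initial covector variation to the raised final one.
  have key (u : W) (hu : u ∈ K) : L (0, S (0, (B u).1.2)) = (0, R (0, (B u).2.2)) := by
    have h1 := congrArg (fun A : W →L[ℝ] E × E ↦ A u) heq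
    have h2 : L ((B u).1.1, S (B u).1) = ((B u).2.1, R (B u).2) := h1
    obtain ⟨h3, h4⟩ := hK u hu
    rw [h3, h4] at h2
    have h5 : (B u).1 = (0, (B u).1.2) := Prod.ext h3 rfl
    have h6 : (B u).2 = (0, (B u).2.2) := Prod.ext h4 rfl
    rwa [h5, h6] at h2
  -- With the base point fixed, `S` is the inverse metric, hence injective.
  have hS0 (y : E →L[ℝ] ℝ) (h : S (0, y) = 0) : y = 0 := by
    have := hS' (0, y)
    rw [h, map_zero, map_zero, zero_apply, add_zero] at this
    exact this.symm
  have hR0 (y : E →L[ℝ] ℝ) (h : R (0, y) = 0) : y = 0 := by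
    have := hR' (0, y)
    rw [h, map_zero, map_zero, zero_apply, add_zero] at this
    exact this.symm
  let T : W →ₗ[ℝ] E := (S ∘L ContinuousLinearMap.inr ℝ E (E →L[ℝ] ℝ) ∘L
    ContinuousLinearMap.snd ℝ E (E →L[ℝ] ℝ) ∘L ContinuousLinearMap.fst ℝ _ _ ∘L B).toLinearMap
  let T' : K →ₗ[ℝ] TangentSpace 𝓘(ℝ, E) α.proj := T ∘ₗ K.subtype
  have hT' (u : K) : T' u ∈ expKer (E := E) α.proj (sharpVec (E := E) α) :=
    -- The differential of the exponential map is the block of `L` from fibre to base, so the base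
    -- component of `key` is membership in its kernel.
    (hker (T u)).2 (congrArg Prod.fst (key u u.2))
  have : FiniteDimensional ℝ (TangentSpace 𝓘(ℝ, E) α.proj) :=
    inferInstanceAs (FiniteDimensional ℝ E)
  refine LinearMap.finrank_le_finrank_of_injective (f := T'.codRestrict _ hT') ?_
  rw [← LinearMap.ker_eq_bot, LinearMap.ker_eq_bot']
  rintro ⟨u, hu⟩ h
  have h1 : S (0, (B u).1.2) = 0 := congrArg Subtype.val h
  have h2 := key u hu
  rw [h1] at h2
  have h3 : R (0, (B u).2.2) = 0 := by
    rw [Prod.mk_zero_zero, map_zero] at h2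
    exact (congrArg Prod.snd h2).symm
  obtain ⟨h4, h5⟩ := hK u hu
  refine Subtype.ext (hinj u hu ?_)
  exact Prod.ext (Prod.ext h4 (hS0 _ h1)) (Prod.ext h5 (hR0 _ h3))

end Degeneracy

end ConjugatePoints

end

noncomputable section

namespace ConjugatePoints

open Filter

/-! ### Second-order data of the graphs of `df` and `dh` -/

section Graphs

/-- On the kernel of the Hessian of `f - h`, the Hessians of `f` and `h` agree. -/
theorem fderiv_fderiv_eq_of_mem_ker {V : Type*} [NormedAddCommGroup V] [NormedSpace ℝ V]
    {f h : V → ℝ} {w₀ : V} (hf : ContDiffAt ℝ ∞ f w₀) (hh : ContDiffAt ℝ ∞ h w₀) {u : V}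
    (hu : fderiv ℝ (fun w ↦ fderiv ℝ (fun w' ↦ f w' - h w') w) w₀ u = 0) :
    fderiv ℝ (fderiv ℝ f) w₀ u = fderiv ℝ (fderiv ℝ h) w₀ u := by
  have h1 : (fun w ↦ fderiv ℝ (fun w' ↦ f w' - h w') w) =ᶠ[𝓝 w₀]
      fun w ↦ fderiv ℝ f w - fderiv ℝ h w := by
    filter_upwards [(hf.of_le (m := 1) (by simp)).eventually (by simp),
      (hh.of_le (m := 1) (by simp)).eventually (by simp)] with w h1 h2
    exact fderiv_fun_sub (h1.differentiableAt (by simp)) (h2.differentiableAt (by simp))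
  have hf' : DifferentiableAt ℝ (fderiv ℝ f) w₀ :=
    (hf.fderiv_right (m := ∞) (by simp)).differentiableAt (by simp)
  have hh' : DifferentiableAt ℝ (fderiv ℝ h) w₀ :=
    (hh.fderiv_right (m := ∞) (by simp)).differentiableAt (by simp)
  rw [h1.fderiv_eq, fderiv_fun_sub hf' hh'] at hu
  exact sub_eq_zero.1 hu

theorem hasFDerivAt_graph_fderiv {V : Type*} [NormedAddCommGroup V] [NormedSpace ℝ V]
    {f : V → ℝ} {w₀ : V} (hf : ContDiffAt ℝ ∞ f w₀) :
    HasFDerivAt (fun w ↦ (w, fderiv ℝ f w))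
      ((ContinuousLinearMap.id ℝ V).prod (fderiv ℝ (fderiv ℝ f) w₀)) w₀ :=
  (hasFDerivAt_id w₀).prodMk
    ((hf.fderiv_right (m := ∞) (by simp)).differentiableAt (by simp)).hasFDerivAt

end Graphs

/-! ### The bound for the degeneracy -/

section Degeneracy

variable {E : Type*} [NormedAddCommGroup E] [NormedSpace ℝ E]
  {M : Type*} [TopologicalSpace M] [ChartedSpace E M] [IsManifold 𝓘(ℝ, E) ∞ M]

/-- The derivative of the inverse of a local diffeomorphism from `T*M × T*M`, in the charts at
`p`. -/
theorem exists_hasFDerivAt_symm {V : Type*} [NormedAddCommGroup V] [NormedSpace ℝ V]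
    (Ψ : OpenPartialHomeomorph (CotangentBundle E M × CotangentBundle E M) V)
    (h1 : ContMDiffOn ((cotangentModel E).prod (cotangentModel E)) 𝓘(ℝ, V) ∞ Ψ Ψ.source)
    (h2 : ContMDiffOn 𝓘(ℝ, V) ((cotangentModel E).prod (cotangentModel E)) ∞ Ψ.symm Ψ.target)
    {p : CotangentBundle E M × CotangentBundle E M} (hp : p ∈ Ψ.source) :
    ∃ Q : V →L[ℝ] (E × (E →L[ℝ] ℝ)) × (E × (E →L[ℝ] ℝ)),
      HasFDerivAt (fun ζ ↦ (extChartAt (cotangentModel E) p.1 (Ψ.symm ζ).1,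
        extChartAt (cotangentModel E) p.2 (Ψ.symm ζ).2)) Q (Ψ p) ∧ ∀ ζ, Q ζ = 0 → ζ = 0 := by
  have ht := Ψ.map_source hp
  have hl := Ψ.left_inv hp
  have h3 := h2.contMDiffAt (Ψ.open_target.mem_nhds ht)
  have h4 := h1.contMDiffAt (Ψ.open_source.mem_nhds hp)
  have hQ1 : ContMDiffAt 𝓘(ℝ, V) 𝓘(ℝ, E × (E →L[ℝ] ℝ)) ∞
      (fun ζ ↦ extChartAt (cotangentModel E) p.1 (Ψ.symm ζ).1) (Ψ p) := by
    refine ContMDiffAt.comp (f := fun ζ ↦ (Ψ.symm ζ).1) (Ψ p) ?_ h3.fst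
    rw [hl]
    exact contMDiffAt_extChartAt
  have hQ2 : ContMDiffAt 𝓘(ℝ, V) 𝓘(ℝ, E × (E →L[ℝ] ℝ)) ∞
      (fun ζ ↦ extChartAt (cotangentModel E) p.2 (Ψ.symm ζ).2) (Ψ p) := by
    refine ContMDiffAt.comp (f := fun ζ ↦ (Ψ.symm ζ).2) (Ψ p) ?_ h3.snd
    rw [hl]
    exact contMDiffAt_extChartAt
  have hQ := (hQ1.contDiffAt.prodMk hQ2.contDiffAt).differentiableAt (by simp) |>.hasFDerivAt
  refine ⟨_, hQ, ?_⟩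
  set p' : (E × (E →L[ℝ] ℝ)) × (E × (E →L[ℝ] ℝ)) :=
    (extChartAt (cotangentModel E) p.1 p.1, extChartAt (cotangentModel E) p.2 p.2) with hp'
  have hsymm (α : CotangentBundle E M) : ContMDiffAt 𝓘(ℝ, E × (E →L[ℝ] ℝ)) (cotangentModel E) ∞
      (extChartAt (cotangentModel E) α).symm (extChartAt (cotangentModel E) α α) :=
    (contMDiffOn_extChartAt_symm α).contMDiffAt (extChartAt_target_mem_nhds α)
  have hR1 : ContMDiffAt 𝓘(ℝ, (E × (E →L[ℝ] ℝ)) × (E × (E →L[ℝ] ℝ)))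
      ((cotangentModel E).prod (cotangentModel E)) ∞
      (fun q : (E × (E →L[ℝ] ℝ)) × (E × (E →L[ℝ] ℝ)) ↦
        ((extChartAt (cotangentModel E) p.1).symm q.1,
          (extChartAt (cotangentModel E) p.2).symm q.2)) p' :=
    (ContMDiffAt.comp (f := Prod.fst) p' (hsymm p.1) contDiffAt_fst.contMDiffAt).prodMk
      (ContMDiffAt.comp (f := Prod.snd) p' (hsymm p.2) contDiffAt_snd.contMDiffAt)
  have hR2 : ContMDiffAt 𝓘(ℝ, (E × (E →L[ℝ] ℝ)) × (E × (E →L[ℝ] ℝ))) 𝓘(ℝ, V) ∞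
      (fun q : (E × (E →L[ℝ] ℝ)) × (E × (E →L[ℝ] ℝ)) ↦
        Ψ ((extChartAt (cotangentModel E) p.1).symm q.1,
          (extChartAt (cotangentModel E) p.2).symm q.2)) p' := by
    refine ContMDiffAt.comp (g := Ψ) p' ?_ hR1
    rwa [hp', (extChartAt (cotangentModel E) p.1).left_inv (mem_extChartAt_source p.1),
      (extChartAt (cotangentModel E) p.2).left_inv (mem_extChartAt_source p.2)]
  have hR := hR2.contDiffAt.differentiableAt (by simp) |>.hasFDerivAt
  have hQp : (fun ζ ↦ (extChartAt (cotangentModel E) p.1 (Ψ.symm ζ).1,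
        extChartAt (cotangentModel E) p.2 (Ψ.symm ζ).2)) (Ψ p) = p' := by
    simp only [hl, hp']
  rw [← hQp] at hR
  have hcomp := hR.comp (Ψ p) hQ
  -- `Ψ` in charts composed with its inverse is the identity near `Ψ p`, so `Q` has a left inverse.
  have hid := hcomp.unique ((hasFDerivAt_id (𝕜 := ℝ) (Ψ p)).congr_of_eventuallyEq (by
    have hc : ContinuousAt Ψ.symm (Ψ p) := Ψ.continuousAt_symm ht
    have hc1 := (continuousAt_fst.comp hc).eventually
      ((isOpen_extChartAt_source (I := cotangentModel E) p.1).mem_nhds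
        (by simp only [Function.comp_apply, hl]; exact mem_extChartAt_source p.1))
    have hc2 := (continuousAt_snd.comp hc).eventually
      ((isOpen_extChartAt_source (I := cotangentModel E) p.2).mem_nhds
        (by simp only [Function.comp_apply, hl]; exact mem_extChartAt_source p.2))
    filter_upwards [Ψ.open_target.mem_nhds ht, hc1, hc2] with ζ hζ hζ1 hζ2
    simp only [Function.comp_apply] at hζ1 hζ2 ⊢
    rw [(extChartAt (cotangentModel E) p.1).left_inv hζ1,
      (extChartAt (cotangentModel E) p.2).left_inv hζ2]
    exact Ψ.right_inv hζ))
  intro ζ hζ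
  have := congrArg (fun A : V →L[ℝ] V ↦ A ζ) hid
  simp only [ContinuousLinearMap.comp_apply] at this
  rw [hζ, map_zero] at this
  exact this.symm

variable [FiniteDimensional ℝ E] [RiemannianBundle (fun x : M ↦ TangentSpace 𝓘(ℝ, E) x)]
  [IsContMDiffRiemannianBundle 𝓘(ℝ, E) ∞ E (fun x : M ↦ TangentSpace 𝓘(ℝ, E) x)] [T2Space M]

/-- The base point `w` of the graph of `df` parametrises the flow graph near `p`, and the Hessian
kernel consists of directions in which this graph is tangent to that of `dh`, the image of the
boundary set. -/
theorem HasDegeneracy.lt_finrank [Nontrivial E] {x X : M}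
    {p : CotangentBundle E M × CotangentBundle E M}
    (hp : p ∈ flowGraph E M ∩ boundarySet E x X) {m : ℕ}
    (h : HasDegeneracy (flowGraph E M) (boundarySet E x X) p m) : m < finrank ℝ E := by
  obtain ⟨Ψ, D, f, h, ⟨hΨ1, hΨ2, -⟩, hpΨ, hD, hf, hh, hΓ, hB, rfl⟩ := h
  obtain ⟨hpΓ, rfl, rfl⟩ := hp
  have hΓ' (w : E × E) (hw : w ∈ D) : (w, fderiv ℝ f w) ∈ Ψ.target ∧
      Ψ.symm (w, fderiv ℝ f w) ∈ flowGraph E M := by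
    obtain ⟨g, ⟨hg1, hg2⟩, hg3⟩ : (w, fderiv ℝ f w) ∈ Ψ '' (flowGraph E M ∩ Ψ.source) :=
      hΓ ▸ ⟨w, hw, rfl⟩
    rw [← hg3, Ψ.left_inv hg2]
    exact ⟨Ψ.map_source hg2, hg1⟩
  have hB' (w : E × E) (hw : w ∈ D) :
      Ψ.symm (w, fderiv ℝ h w) ∈ boundarySet E p.1.proj p.2.proj := by
    obtain ⟨g, ⟨hg1, hg2⟩, hg3⟩ :
        (w, fderiv ℝ h w) ∈ Ψ '' (boundarySet E p.1.proj p.2.proj ∩ Ψ.source) :=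
      hB ▸ ⟨w, hw, rfl⟩
    rw [← hg3, Ψ.left_inv hg2]
    exact hg1
  obtain ⟨w₀, hw₀, hf₀⟩ : Ψ p ∈ (fun w ↦ (w, fderiv ℝ f w)) '' D :=
    hΓ ▸ ⟨p, ⟨hpΓ, hpΨ⟩, rfl⟩
  obtain ⟨w₁, hw₁, hh₀⟩ : Ψ p ∈ (fun w ↦ (w, fderiv ℝ h w)) '' D :=
    hB ▸ ⟨p, ⟨⟨rfl, rfl⟩, hpΨ⟩, rfl⟩
  -- `p` lies in both sets, so both graphs pass through `Ψ p`, over the same base point.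
  obtain rfl : w₁ = w₀ := (congrArg Prod.fst hh₀).trans (congrArg Prod.fst hf₀).symm
  have hf₀ : (w₁, fderiv ℝ f w₁) = Ψ p := hf₀
  have hh₀ : (w₁, fderiv ℝ h w₁) = Ψ p := hh₀
  have hfst : (Ψ p).1 = w₁ := by rw [← hf₀]
  rw [hfst]
  have hDn := hD.mem_nhds hw₀
  have hfc := hf.contDiffAt hDn
  have hhc := hh.contDiffAt hDn
  obtain ⟨Q, hQ, hQ0⟩ := exists_hasFDerivAt_symm Ψ hΨ1 hΨ2 hpΨ
  have hfd := hasFDerivAt_graph_fderiv hfc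
  have hhd := hasFDerivAt_graph_fderiv hhc
  have hBf := HasFDerivAt.comp (f := fun w ↦ (w, fderiv ℝ f w)) w₁ (by rw [hf₀]; exact hQ) hfd
  have hBh := HasFDerivAt.comp (f := fun w ↦ (w, fderiv ℝ h w)) w₁ (by rw [hh₀]; exact hQ) hhd
  set σ : E × E → CotangentBundle E M × CotangentBundle E M :=
    fun w ↦ Ψ.symm (w, fderiv ℝ f w) with hσ
  have hσ₀ : σ w₁ = p := by rw [hσ]; simp only [hf₀, Ψ.left_inv hpΨ]
  have hσc : ContinuousAt σ w₁ :=
    ContinuousAt.comp (f := fun w ↦ (w, fderiv ℝ f w))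
      (Ψ.continuousAt_symm (hΓ' w₁ hw₀).1) hfd.continuousAt
  set K := LinearMap.ker
    (fderiv ℝ (fun w ↦ fderiv ℝ (fun w' ↦ f w' - h w') w) w₁).toLinearMap
  have hK (u : E × E) (hu : u ∈ K) : (Q (u, fderiv ℝ (fderiv ℝ f) w₁ u)).1.1 = 0 ∧
      (Q (u, fderiv ℝ (fderiv ℝ f) w₁ u)).2.1 = 0 := by
    -- Replacing the Hessian of `f` by that of `h` makes the vector tangent to the boundary set,
    -- where both base points are constant.
    rw [fderiv_fderiv_eq_of_mem_ker hfc hhc hu]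
    constructor
    · have h1 := hBh.fst.fst.unique ((hasFDerivAt_const
        (extChartAt 𝓘(ℝ, E) p.1.proj p.1.proj) w₁).congr_of_eventuallyEq (by
          filter_upwards [hDn] with w hw
          exact congrArg (extChartAt 𝓘(ℝ, E) p.1.proj) (hB' w hw).1))
      exact congrArg (fun A : E × E →L[ℝ] E ↦ A u) h1
    · have h1 := hBh.snd.fst.unique ((hasFDerivAt_const
        (extChartAt 𝓘(ℝ, E) p.2.proj p.2.proj) w₁).congr_of_eventuallyEq (by
          filter_upwards [hDn] with w hw
          exact congrArg (extChartAt 𝓘(ℝ, E) p.2.proj) (hB' w hw).2))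
      exact congrArg (fun A : E × E →L[ℝ] E ↦ A u) h1
  have hσΓ : ∀ᶠ w in 𝓝 w₁, σ w ∈ flowGraph E M := by
    filter_upwards [hDn] with w hw using (hΓ' w hw).2
  -- `Q` is injective and `u` is the first entry of `(u, D²f u)`, so no nonzero `u` gives a trivial
  -- variation.
  obtain ⟨hdom, hle⟩ := finrank_le_finrank_expKer hσc hσΓ (by rw [hσ₀]; exact hBf) (K := K) hK
    (fun u _ hu ↦ congrArg Prod.fst (hQ0 _ hu))
  exact hle.trans_lt (finrank_expKer_lt hdom)

end Degeneracy

end ConjugatePoints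

end

open ConjugatePoints in
theorem mainTheorem6
    {E : Type*} [NormedAddCommGroup E] [NormedSpace ℝ E] [FiniteDimensional ℝ E]
    {M : Type*} [TopologicalSpace M] [T2Space M] [ChartedSpace E M] [IsManifold 𝓘(ℝ, E) ∞ M]
    [RiemannianBundle (fun x : M ↦ TangentSpace 𝓘(ℝ, E) x)]
    [IsContMDiffRiemannianBundle 𝓘(ℝ, E) ∞ E (fun x : M ↦ TangentSpace 𝓘(ℝ, E) x)]
    (n : ℕ) (hn : finrank ℝ E = n) :
    (∀ (x : M) (v : TangentSpace 𝓘(ℝ, E) x), IsConjugateAlong x v →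
      conjMultiplicity x v < n) ∧
    (∀ x X : M, X ∈ conjugateLocus E x →
      ∀ p ∈ flowGraph E M ∩ boundarySet E x X, ∀ m : ℕ,
        HasDegeneracy (flowGraph E M) (boundarySet E x X) p m → m < n) := by
  subst hn
  refine ⟨fun x v hv ↦ ?_, fun x X hX p hp m hm ↦ ?_⟩
  · have := hv.nontrivial
    exact finrank_expKer_lt hv.1
  -- A conjugate vector has a nonzero kernel vector, so the dimension is positive, as the strict
  -- bound requires. The degeneracy itself is estimated at `g⁻¹ α`, not at this `v`.
  · obtain ⟨v, hv, -⟩ := hX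
    have := hv.nontrivial
    exact hm.lt_finrank hp
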